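/- Let $d\ge 0$ be an integer, $T>0$, $\delta>0$, $r>0$, $c,\mu\in\mathbb R$ with $\mu>c$, let $A,C\in\mathbb R^{d\times d}$, $B,D\in\mathbb R^{d}$, and let $Q,G\in\mathbb R^{d\times d}$ be symmetric positive semidefinite. Let $H^1(0,1)$ carry the inner product $\langle u,v\rangle_{H^1}=\int_0^1 uv\,dx+\int_0^1u'v'\,dx$, and let $\mathcal H=\mathbb R^d\times\mathbb R\times H^1(0,1)$ be the Hilbert sum. Let $\rho$ be the solution of $-\rho''+(\mu-c)\rho=0$ on $(0,1)$, $\rho'(0)=0$, $\rho'(1)=1$, and let $\gamma_0^*z=z(0)$ for $z\in H^1(0,1)$. Define on $\mathcal H$ $$\tilde\Delta=\begin{pmatrix}0&0&0\\0&0&0\\0&0&\Delta\end{pmatrix},\quad \tilde A=\begin{pmatrix}A&-B\rho(0)&B\gamma_0^*\\0&\mu&0\\0&0&c\end{pmatrix},\quad \tilde C=\begin{pmatrix}C&-D\rho(0)&D\gamma_0^*\\0&0&0\\0&0&0\end{pmatrix},\quad \tilde B=\begin{pmatrix}0\\1\\-\rho\end{pmatrix},$$ $\tilde Q=\mathrm{diag}(Q,r,0)$,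 $\tilde G=\mathrm{diag}(G,0,0)$, where $\Delta z=z''$ is the Neumann Laplacian in $H^1(0,1)$, with domain $\{z\in H^2(0,1): z'(0)=z'(1)=0,\ z''\in H^1(0,1)\}$. Let $S$ be the strongly continuous semigroup on $\mathcal H$ generated by $\tilde\Delta$, and let $\Pi$ be the mild solution on $[0,T]$ of $$\dot\Pi+\Pi(\tilde\Delta+\tilde A)+(\tilde\Delta+\tilde A^*)\Pi+\tilde C^*\Pi\tilde C+\tilde Q-\delta^{-1}\Pi\tilde B\tilde B^*\Pi=0,\qquad \Pi(T)=\tilde G,$$ that is, $\Pi:[0,T]\to\mathcal L(\mathcal H)$ is strongly continuous and for all $t\in[0,T]$, $Z\in\mathcal H$, $$\Pi(t)Z=S(T-t)^*\tilde GS(T-t)Z+\int_t^TS(\tau-t)^*\bigl(\Pi(\tau)\tilde A+\tilde A^*\Pi(\tau)+\tilde C^*\Pi(\tau)\tilde C+\tilde Q-\delta^{-1}\Pi(\tau)\tilde B\tilde B^*\Pi(\tau)\bigr)S(\tau-t)Z\,d\tau .$$ For $n\ge 0$ let $\phi_n=A_n\cos(n\pi\,\cdot)$, where $A_0=1$ and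 $A_n=\sqrt{2/(1+\pi^2n^2)}$ for $n\ge1$. For $N\ge 0$ let $\mathcal H_N=\mathbb R^d\times\mathbb R\times\mathrm{span}(\phi_0,\dots,\phi_N)$, let $P_N:\mathcal H\to\mathcal H_N$ be the orthogonal projection, and put $\tilde\Delta_N=P_N\tilde\Delta P_N^*$, $\tilde A_N=P_N\tilde AP_N^*$, $\tilde C_N=P_N\tilde CP_N^*$, $\tilde Q_N=P_N\tilde QP_N^*$, $\tilde G_N=P_N\tilde GP_N^*$, $\tilde B_N=P_N\tilde B$. Let $\Pi_N:[0,T]\to\mathcal L(\mathcal H_N)$ be the solution of $$\dot\Pi_N+\Pi_N(\tilde\Delta_N+\tilde A_N)+(\tilde\Delta_N+\tilde A_N^*)\Pi_N+\tilde C_N^*\Pi_N\tilde C_N+\tilde Q_N-\delta^{-1}\Pi_N\tilde B_N\tilde B_N^*\Pi_N=0,\qquad \Pi_N(T)=\tilde G_N .$$ Then for every $Z\in\mathcal H$, as $N\to\infty$, $$\|\Pi(t)Z-P_N^*\Pi_N(t)P_NZ\|_{\mathcal H}\to0\ \text{ for every }t\in[0,T],\qquad \sup_{t\in[0,T]}\|\Pi(t)Z-P_N^*\Pi_N(t)P_NZ\|_{\mathcal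 H}\to0 .$$ -/

import Mathlib

open MeasureTheory Set Filter Topology
open scoped ContDiff RealInnerProductSpace

noncomputable section

namespace SpectralRiccati

/-- Lebesgue measure on the open interval `(0,1)`. -/
abbrev μI : Measure ℝ := volume.restrict (Ioo (0 : ℝ) 1)

/-- The real Hilbert space `L²(0,1)`. -/
abbrev L2 : Type := Lp ℝ 2 μI

/-- `g` is the weak (distributional) derivative of `f` on `(0,1)`. -/
def IsWeakDeriv (f g : ℝ → ℝ) : Prop :=
  ∀ φ : ℝ → ℝ, ContDiff ℝ ∞ φ → HasCompactSupport φ → tsupport φ ⊆ Ioo 0 1 →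
    ∫ x, f x * deriv φ x ∂μI = -∫ x, g x * φ x ∂μI

theorem interval_eq (f : ℝ → ℝ) : ∫ x in (0 : ℝ)..1, f x = ∫ x, f x ∂μI := by
  rw [intervalIntegral.integral_of_le zero_le_one, integral_Ioc_eq_integral_Ioo]

theorem memLp_of_continuous {f : ℝ → ℝ} (hf : Continuous f) : MemLp f 2 μI := by
  obtain ⟨C, hC⟩ := isCompact_Icc.exists_bound_of_continuousOn (s := Icc (0 : ℝ) 1) hf.continuousOn
  refine MemLp.of_bound hf.aestronglyMeasurable C ?_
  filter_upwards [ae_restrict_mem measurableSet_Ioo] with x hx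
  exact hC x (Ioo_subset_Icc_self hx)

theorem integrable_mul_continuous (f : L2) {φ : ℝ → ℝ} (hφ : Continuous φ) :
    Integrable (fun x => f x * φ x) μI :=
  (Lp.memLp f).integrable_mul (memLp_of_continuous hφ)

theorem integral_mul_eq_inner (f : L2) {φ : ℝ → ℝ} (hφ : Continuous φ) :
    ∫ x, f x * φ x ∂μI = ⟪(memLp_of_continuous hφ).toLp φ, f⟫ := by
  rw [L2.inner_def]
  refine integral_congr_ae ?_
  filter_upwards [(memLp_of_continuous hφ).coeFn_toLp] with x hx
  simp [hx]

/-- The Sobolev space `H¹(0,1)`, as the space of pairs `(u, u')` in `L²(0,1) × L²(0,1)` such that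
`u'` is the weak derivative of `u`. Its inner product is the one of the Hilbert sum, that is,
`∫ u v + ∫ u' v'`. -/
def H1sub : Submodule ℝ (WithLp 2 (L2 × L2)) where
  carrier := {p | IsWeakDeriv p.fst p.snd}
  zero_mem' := by
    intro φ _ _ _
    have h0 : ((0 : L2) : ℝ → ℝ) =ᵐ[μI] 0 := Lp.coeFn_zero ℝ 2 μI
    have h1 : ∫ x, ((0 : L2) : ℝ → ℝ) x * deriv φ x ∂μI = 0 := by
      rw [integral_eq_zero_of_ae]; filter_upwards [h0] with x hx; rw [hx]; simp
    have h2 : ∫ x, ((0 : L2) : ℝ → ℝ) x * φ x ∂μI = 0 := by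
      rw [integral_eq_zero_of_ae]; filter_upwards [h0] with x hx; rw [hx]; simp
    simp only [WithLp.zero_fst, WithLp.zero_snd]
    rw [h1, h2, neg_zero]
  add_mem' := by
    intro p q hp hq φ h1 h2 h3
    have hd : Continuous (deriv φ) := h1.continuous_deriv (by simp)
    have hp' := hp φ h1 h2 h3
    have hq' := hq φ h1 h2 h3
    rw [integral_mul_eq_inner _ hd, integral_mul_eq_inner _ h1.continuous] at *
    rw [WithLp.add_fst, WithLp.add_snd, inner_add_right, inner_add_right, hp', hq']
    ring
  smul_mem' := by
    intro c p hp φ h1 h2 h3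
    have hd : Continuous (deriv φ) := h1.continuous_deriv (by simp)
    have hp' := hp φ h1 h2 h3
    rw [integral_mul_eq_inner _ hd, integral_mul_eq_inner _ h1.continuous] at *
    rw [WithLp.smul_fst, WithLp.smul_snd, inner_smul_right, inner_smul_right, hp']
    ring

/-- The Hilbert space `H¹(0,1)`. -/
def H1 : Type := H1sub

instance : NormedAddCommGroup H1 := inferInstanceAs (NormedAddCommGroup H1sub)

instance : InnerProductSpace ℝ H1 := inferInstanceAs (InnerProductSpace ℝ H1sub)

theorem isClosed_H1sub : IsClosed (H1sub : Set (WithLp 2 (L2 × L2))) := by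
  have : (H1sub : Set (WithLp 2 (L2 × L2))) =
      ⋂ (φ : ℝ → ℝ) (h1 : ContDiff ℝ ∞ φ) (_ : HasCompactSupport φ) (_ : tsupport φ ⊆ Ioo 0 1),
        {p | ⟪(memLp_of_continuous (h1.continuous_deriv (by simp))).toLp (deriv φ), p.fst⟫ =
          -⟪(memLp_of_continuous h1.continuous).toLp φ, p.snd⟫} := by
    ext p
    simp only [mem_iInter, mem_ofPred_eq]
    refine forall_congr' fun φ => forall_congr' fun h1 => forall_congr' fun h2 =>
      forall_congr' fun h3 => ?_
    rw [integral_mul_eq_inner _ (h1.continuous_deriv (by simp)),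
      integral_mul_eq_inner _ h1.continuous]
  rw [this]
  refine isClosed_iInter fun φ => isClosed_iInter fun h1 => isClosed_iInter fun h2 =>
    isClosed_iInter fun h3 => isClosed_eq ?_ ?_
  · exact continuous_const.inner (WithLp.fstL 2 ℝ L2 L2).continuous
  · exact (continuous_const.inner (WithLp.sndL 2 ℝ L2 L2).continuous).neg

instance : CompleteSpace H1 := by
  have : CompleteSpace H1sub := isClosed_H1sub.completeSpace_coe
  exact this

namespace H1

/-- The element `u` of `L²(0,1)` underlying an element of `H¹(0,1)`. -/
def fn (u : H1) : L2 := u.1.fst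

/-- The weak derivative `u'` of an element `u` of `H¹(0,1)`. -/
def der (u : H1) : L2 := u.1.snd

theorem isWeakDeriv (u : H1) : IsWeakDeriv u.fn u.der := u.2

/-- A function of class `C¹`, as an element of `H¹(0,1)`. -/
def ofC1 (f f' : ℝ → ℝ) (hf : ∀ x, HasDerivAt f (f' x) x) (hf' : Continuous f') : H1 :=
  ⟨WithLp.toLp 2
    ((memLp_of_continuous (continuous_iff_continuousAt.2 fun x => (hf x).continuousAt)).toLp f,
      (memLp_of_continuous hf').toLp f'), by
    intro φ h1 h2 h3
    have hφ0 : φ 0 = 0 := image_eq_zero_of_notMem_tsupport fun h => lt_irrefl _ (h3 h).1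
    have hφ1 : φ 1 = 0 := image_eq_zero_of_notMem_tsupport fun h => lt_irrefl _ (h3 h).2
    have hc : Continuous f := continuous_iff_continuousAt.2 fun x => (hf x).continuousAt
    have e1 : ∫ x, ((memLp_of_continuous hc).toLp f : ℝ → ℝ) x * deriv φ x ∂μI =
        ∫ x in (0 : ℝ)..1, f x * deriv φ x := by
      rw [interval_eq]
      refine integral_congr_ae ?_
      filter_upwards [(memLp_of_continuous hc).coeFn_toLp] with x hx
      rw [hx]
    have e2 : ∫ x, ((memLp_of_continuous hf').toLp f' : ℝ → ℝ) x * φ x ∂μI =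
        ∫ x in (0 : ℝ)..1, f' x * φ x := by
      rw [interval_eq]
      refine integral_congr_ae ?_
      filter_upwards [(memLp_of_continuous hf').coeFn_toLp] with x hx
      rw [hx]
    refine e1.trans (Eq.trans ?_ (congrArg Neg.neg e2.symm))
    rw [intervalIntegral.integral_mul_deriv_eq_deriv_mul (fun x _ => hf x)
      (fun x _ => (h1.differentiable (by simp) x).hasDerivAt) (hf'.intervalIntegrable _ _)
      ((h1.continuous_deriv (by simp)).intervalIntegrable _ _), hφ0, hφ1]
    ring⟩

end H1

theorem intervalIntegrable_L2 (g : L2) : IntervalIntegrable g volume 0 1 := by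
  rw [intervalIntegrable_iff_integrableOn_Ioo_of_le zero_le_one]
  exact (Lp.memLp g).integrable (by norm_num)

/-- Integration by parts against the primitive of a square integrable function. -/
theorem integral_primitive_mul (g : L2) {φ φ' : ℝ → ℝ} (hφ : ∀ x, HasDerivAt φ (φ' x) x)
    (hφ' : Continuous φ') :
    ∫ x in (0 : ℝ)..1, (∫ y in (0 : ℝ)..x, g y) * φ' x =
      (∫ y in (0 : ℝ)..1, g y) * φ 1 - ∫ x in (0 : ℝ)..1, g x * φ x := by
  have hg := intervalIntegrable_L2 g
  have hG := hg.absolutelyContinuousOnInterval_intervalIntegral (c := 0) (by simp)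
  have hder : φ' = deriv φ := by ext x; exact (hφ x).deriv.symm
  have hcd : ContDiff ℝ 1 φ := by
    rw [contDiff_one_iff_deriv]
    exact ⟨fun x => (hφ x).differentiableAt, hder ▸ hφ'⟩
  have hφa : AbsolutelyContinuousOnInterval φ 0 1 :=
    hcd.contDiffOn.absolutelyContinuousOnInterval
  rw [hder, hG.integral_mul_deriv_eq_deriv_mul hφa]
  simp only [intervalIntegral.integral_same, zero_mul, sub_zero]
  congr 1
  refine intervalIntegral.integral_congr_ae ?_
  filter_upwards [hg.ae_hasDerivAt_integral] with x hx hx'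
  rw [(hx (uIoc_subset_uIcc hx') 0 (by simp)).deriv]

/-- Every element of `H¹(0,1)` is almost everywhere equal to a constant plus the primitive of its
weak derivative. -/
theorem H1.exists_ae_eq (u : H1) :
    ∃ c : ℝ, ∀ᵐ x ∂μI, u.fn x = c + ∫ y in (0 : ℝ)..x, u.der y := by
  set G : ℝ → ℝ := fun x => ∫ y in (0 : ℝ)..x, u.der y with hG
  have hGc : ContinuousOn G (Icc 0 1) := by
    have := ((intervalIntegrable_L2 u.der).absolutelyContinuousOnInterval_intervalIntegral
      (c := 0) (by simp)).continuousOn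
    rwa [uIcc_of_le zero_le_one] at this
  have hGi : ∀ φ : ℝ → ℝ, Continuous φ → Integrable (fun x => G x * φ x) μI := fun φ hφ =>
    ((hGc.mul hφ.continuousOn).integrableOn_Icc).mono_set Ioo_subset_Icc_self
  set w : ℝ → ℝ := fun x => u.fn x - G x with hw
  have hwi : ∀ φ : ℝ → ℝ, Continuous φ → Integrable (fun x => w x * φ x) μI := fun φ hφ => by
    have := (integrable_mul_continuous u.fn hφ).sub (hGi φ hφ)
    refine this.congr (ae_of_all _ fun x => ?_)
    simp [hw, sub_mul]
  have hw1 : Integrable w μI := by simpa using hwi (fun _ => 1) continuous_const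
  have key : ∀ φ : ℝ → ℝ, ContDiff ℝ ∞ φ → HasCompactSupport φ → tsupport φ ⊆ Ioo 0 1 →
      ∫ x, w x * deriv φ x ∂μI = 0 := by
    intro φ h1 h2 h3
    have hφ1 : φ 1 = 0 := image_eq_zero_of_notMem_tsupport fun h => lt_irrefl _ (h3 h).2
    have hd : Continuous (deriv φ) := h1.continuous_deriv (by simp)
    have hI := integral_primitive_mul u.der
      (fun x => (h1.differentiable (by simp) x).hasDerivAt) hd
    rw [interval_eq, interval_eq (fun x => u.der x * φ x), hφ1, mul_zero, zero_sub] at hI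
    have : ∫ x, w x * deriv φ x ∂μI =
        (∫ x, u.fn x * deriv φ x ∂μI) - ∫ x, G x * deriv φ x ∂μI := by
      rw [← integral_sub (integrable_mul_continuous u.fn hd) (hGi _ hd)]
      simp [hw, sub_mul]
    rw [this, hI, u.isWeakDeriv φ h1 h2 h3, sub_self]
  -- a bump function of integral one
  let b : ContDiffBump (1 / 2 : ℝ) := ⟨1 / 8, 1 / 4, by norm_num, by norm_num⟩
  set ψ₀ : ℝ → ℝ := b.normed volume with hψ₀
  have hb1 : ContDiff ℝ ∞ ψ₀ := b.contDiff_normed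
  have hb2 : HasCompactSupport ψ₀ := b.hasCompactSupport_normed
  have hb3 : tsupport ψ₀ ⊆ Ioo 0 1 := by
    rw [hψ₀, b.tsupport_normed_eq]
    intro x hx
    rw [Metric.mem_closedBall, Real.dist_eq, abs_le] at hx
    have : b.rOut = 1 / 4 := rfl
    constructor <;> linarith [hx.1, hx.2]
  have full : ∀ ψ : ℝ → ℝ, tsupport ψ ⊆ Ioo 0 1 → ∫ x in (0 : ℝ)..1, ψ x = ∫ x, ψ x := by
    intro ψ h
    rw [interval_eq, setIntegral_eq_integral_of_forall_compl_eq_zero]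
    exact fun x hx => image_eq_zero_of_notMem_tsupport fun h' => hx (h h')
  have hb4 : ∫ x in (0 : ℝ)..1, ψ₀ x = 1 := by
    rw [full _ hb3]; exact b.integral_normed
  refine ⟨∫ x, w x * ψ₀ x ∂μI, ?_⟩
  set c : ℝ := ∫ x, w x * ψ₀ x ∂μI with hc
  have main : ∀ᵐ x ∂volume, x ∈ Ioo (0 : ℝ) 1 → w x - c = 0 := by
    refine isOpen_Ioo.ae_eq_zero_of_integral_contDiff_smul_eq_zero ?_ ?_
    · exact IntegrableOn.locallyIntegrableOn
        (hw1.sub (integrable_const c))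
    · intro ψ h1 h2 h3
      set m : ℝ := ∫ x in (0 : ℝ)..1, ψ x with hm
      set θ : ℝ → ℝ := fun x => ψ x - m * ψ₀ x with hθ
      have hθc : ContDiff ℝ ∞ θ := h1.sub (contDiff_const.mul hb1)
      set K : Set ℝ := tsupport ψ ∪ tsupport ψ₀ with hK
      have hKc : IsCompact K := h2.isCompact.union hb2.isCompact
      have hKs : K ⊆ Ioo 0 1 := union_subset h3 hb3
      have hθ0 : ∀ x, x ∉ K → θ x = 0 := by
        intro x hx
        have := image_eq_zero_of_notMem_tsupport fun h => hx (Or.inl h)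
        have h' := image_eq_zero_of_notMem_tsupport fun h => hx (Or.inr h)
        simp [hθ, this, h']
      set φ : ℝ → ℝ := fun x => ∫ y in (0 : ℝ)..x, θ y with hφ
      have hφd : ∀ x, HasDerivAt φ (θ x) x := fun x =>
        intervalIntegral.integral_hasDerivAt_right (hθc.continuous.intervalIntegrable _ _)
          (hθc.continuous.stronglyMeasurableAtFilter _ _) hθc.continuous.continuousAt
      have hφder : deriv φ = θ := funext fun x => (hφd x).deriv
      have hφs : ContDiff ℝ ∞ φ := by
        rw [contDiff_infty_iff_deriv]
        exact ⟨fun x => (hφd x).differentiableAt, hφder ▸ hθc⟩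
      have hθI : ∫ x in (0 : ℝ)..1, θ x = 0 := by
        simp only [hθ]
        rw [intervalIntegral.integral_sub (g := fun x => m * ψ₀ x) (h1.continuous.intervalIntegrable _ _)
          ((continuous_const.mul hb1.continuous).intervalIntegrable _ _),
          intervalIntegral.integral_const_mul, hb4, ← hm]
        ring
      obtain ⟨α, hα, β, hβ, hαβ⟩ : ∃ α, 0 < α ∧ ∃ β, β < 1 ∧ K ⊆ Icc α β := by
        have hne : K.Nonempty := by
          have : (∫ x in (0 : ℝ)..1, ψ₀ x) ≠ 0 := by rw [hb4]; norm_num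
          by_contra hK0
          rw [not_nonempty_iff_eq_empty] at hK0
          apply this
          have : ∀ x, ψ₀ x = 0 := fun x => image_eq_zero_of_notMem_tsupport fun h => by
            have : x ∈ K := Or.inr h
            simp [hK0] at this
          simp [this]
        obtain ⟨p, hp, hp'⟩ := hKc.exists_isLeast hne
        obtain ⟨q, hq, hq'⟩ := hKc.exists_isGreatest hne
        exact ⟨p, (hKs hp).1, q, (hKs hq).2, fun x hx => ⟨hp' hx, hq' hx⟩⟩
      have hφl : ∀ x, x < α → φ x = 0 := by
        intro x hx
        refine (intervalIntegral.integral_congr (g := fun _ => 0) fun y hy => hθ0 y fun h => ?_).trans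
          (by simp)
        have h1 := (hαβ h).1
        have h2 := hy.2
        have : max 0 x < α := max_lt hα hx
        linarith
      have hφr : ∀ x, β < x → φ x = 0 := by
        intro x hx
        have e : φ x = φ 1 + ∫ y in (1 : ℝ)..x, θ y :=
          (intervalIntegral.integral_add_adjacent_intervals
            (hθc.continuous.intervalIntegrable _ _) (hθc.continuous.intervalIntegrable _ _)).symm
        have e1 : φ 1 = 0 := hθI
        rw [e, e1, zero_add]
        refine (intervalIntegral.integral_congr (g := fun _ => 0) fun y hy => hθ0 y fun h => ?_).trans
          (by simp)
        have h1 := (hαβ h).2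
        have h2 := hy.1
        have : β < min 1 x := lt_min hβ hx
        linarith
      have hφt : tsupport φ ⊆ Icc α β := by
        refine closure_minimal (fun x hx => ?_) isClosed_Icc
        by_contra h
        rw [mem_Icc, not_and_or, not_le, not_le] at h
        exact hx (h.elim (hφl x) (hφr x))
      have hfin := key φ hφs (HasCompactSupport.of_support_subset_isCompact isCompact_Icc
        ((subset_tsupport φ).trans hφt)) (hφt.trans fun x hx => ⟨hα.trans_le hx.1, hx.2.trans_lt hβ⟩)
      rw [hφder] at hfin
      have hsplit : ∫ x, w x * θ x ∂μI = (∫ x, w x * ψ x ∂μI) - m * c := by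
        rw [hc, ← integral_const_mul, ← integral_sub (hwi _ h1.continuous)
          ((hwi _ hb1.continuous).const_mul m)]
        refine integral_congr_ae (ae_of_all _ fun x => ?_)
        simp only [hθ]; ring
      have hr : ∫ x, ψ x • (w x - c) = ∫ x, ψ x • (w x - c) ∂μI := by
        rw [setIntegral_eq_integral_of_forall_compl_eq_zero]
        intro x hx
        rw [image_eq_zero_of_notMem_tsupport fun h' => hx (h3 h'), zero_smul]
      rw [hr]
      have : ∫ x, ψ x • (w x - c) ∂μI = (∫ x, w x * ψ x ∂μI) - c * ∫ x, ψ x ∂μI := by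
        rw [← integral_const_mul, ← integral_sub (hwi _ h1.continuous)
          (((memLp_of_continuous h1.continuous).integrable (by norm_num)).const_mul c)]
        refine integral_congr_ae (ae_of_all _ fun x => ?_)
        simp only [smul_eq_mul]; ring
      rw [this, ← interval_eq ψ, ← hm]
      linarith
  filter_upwards [(ae_restrict_iff' measurableSet_Ioo).2 main] with x hx
  have : u.fn x - G x - c = 0 := hx
  linarith

theorem H1.exists_rep (u : H1) :
    ∃ f : ℝ → ℝ, ContinuousOn f (Icc 0 1) ∧ ∀ᵐ x ∂μI, u.fn x = f x := by
  obtain ⟨c, hc⟩ := u.exists_ae_eq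
  refine ⟨_, ?_, hc⟩
  have := ((intervalIntegrable_L2 u.der).absolutelyContinuousOnInterval_intervalIntegral
      (c := 0) (by simp)).continuousOn
  rw [uIcc_of_le zero_le_one] at this
  exact continuousOn_const.add this

/-- The continuous representative on `[0,1]` of an element of `H¹(0,1)`. -/
def H1.rep (u : H1) : ℝ → ℝ := u.exists_rep.choose

theorem H1.continuousOn_rep (u : H1) : ContinuousOn u.rep (Icc 0 1) := u.exists_rep.choose_spec.1

theorem H1.rep_ae_eq (u : H1) : ∀ᵐ x ∂μI, u.fn x = u.rep x := u.exists_rep.choose_spec.2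

theorem H1.rep_unique (u : H1) {f : ℝ → ℝ} (hf : ContinuousOn f (Icc 0 1))
    (h : ∀ᵐ x ∂μI, u.fn x = f x) : EqOn u.rep f (Icc 0 1) := by
  have : u.rep =ᵐ[volume.restrict (Icc (0 : ℝ) 1)] f := by
    rw [← restrict_Ioo_eq_restrict_Icc]
    filter_upwards [h, u.rep_ae_eq] with x h1 h2
    rw [← h1, ← h2]
  exact Measure.eqOn_Icc_of_ae_eq volume zero_ne_one this u.continuousOn_rep hf

theorem H1.rep_zero (u : H1) :
    u.rep 0 = (∫ x, u.fn x ∂μI) + ∫ x, u.der x * (x - 1) ∂μI := by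
  obtain ⟨c, hc⟩ := u.exists_ae_eq
  have hG := ((intervalIntegrable_L2 u.der).absolutelyContinuousOnInterval_intervalIntegral
      (c := 0) (by simp)).continuousOn
  rw [uIcc_of_le zero_le_one] at hG
  have h0 := u.rep_unique (continuousOn_const.add hG) hc (left_mem_Icc.2 zero_le_one)
  have h1 := integral_primitive_mul u.der (φ := fun x => x - 1) (φ' := fun _ => 1)
    (fun x => (hasDerivAt_id x).sub_const 1) continuous_const
  rw [interval_eq, interval_eq (fun x => u.der x * (x - 1))] at h1
  simp only [mul_one, sub_self, mul_zero, zero_sub] at h1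
  rw [h0, integral_congr_ae hc, integral_add (integrable_const c)
    ((hG.integrableOn_Icc).mono_set Ioo_subset_Icc_self), h1]
  simp

theorem H1.rep_add (u v : H1) : EqOn (u + v).rep (fun x => u.rep x + v.rep x) (Icc 0 1) := by
  refine (u + v).rep_unique (u.continuousOn_rep.add v.continuousOn_rep) ?_
  have h : (u + v).fn = u.fn + v.fn := rfl
  filter_upwards [u.rep_ae_eq, v.rep_ae_eq, Lp.coeFn_add u.fn v.fn] with x h1 h2 h3
  rw [h, h3, Pi.add_apply, h1, h2]

theorem H1.rep_smul (a : ℝ) (u : H1) : EqOn (a • u).rep (fun x => a * u.rep x) (Icc 0 1) := by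
  refine (a • u).rep_unique (continuousOn_const.mul u.continuousOn_rep) ?_
  have h : (a • u).fn = a • u.fn := rfl
  filter_upwards [u.rep_ae_eq, Lp.coeFn_smul a u.fn] with x h1 h3
  rw [h, h3, Pi.smul_apply, h1, smul_eq_mul]

theorem H1.rep_zero_apply : EqOn (0 : H1).rep (fun _ => 0) (Icc 0 1) := by
  have := H1.rep_smul 0 0
  simpa using this

theorem H1.ext_fn {u v : H1} (h : u.fn = v.fn) : u = v := by
  have hd : u.der = v.der := by
    refine Lp.ext ?_
    have hi := ((Lp.memLp u.der).integrable (by norm_num)).sub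
      ((Lp.memLp v.der).integrable (by norm_num))
    have : ∀ᵐ x ∂volume, x ∈ Ioo (0 : ℝ) 1 → (u.der x - v.der x) = 0 := by
      refine isOpen_Ioo.ae_eq_zero_of_integral_contDiff_smul_eq_zero
        (IntegrableOn.locallyIntegrableOn hi) fun φ h1 h2 h3 => ?_
      have hr : ∫ x, φ x • (u.der x - v.der x) = ∫ x, φ x • (u.der x - v.der x) ∂μI := by
        rw [setIntegral_eq_integral_of_forall_compl_eq_zero]
        intro x hx
        rw [image_eq_zero_of_notMem_tsupport fun h' => hx (h3 h'), zero_smul]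
      have e : ∫ x, φ x • (u.der x - v.der x) ∂μI =
          (∫ x, u.der x * φ x ∂μI) - ∫ x, v.der x * φ x ∂μI := by
        rw [← integral_sub (integrable_mul_continuous _ h1.continuous)
          (integrable_mul_continuous _ h1.continuous)]
        refine integral_congr_ae (ae_of_all _ fun x => ?_)
        simp only [smul_eq_mul]; ring
      have e1 := u.isWeakDeriv φ h1 h2 h3
      have e2 := v.isWeakDeriv φ h1 h2 h3
      rw [h] at e1
      rw [hr, e]
      linarith
    filter_upwards [(ae_restrict_iff' measurableSet_Ioo).2 this] with x hx
    linarith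
  exact Subtype.ext ((WithLp.ofLp_injective 2) (Prod.ext h hd))

/-- Evaluation at the point `0`, `z ↦ z(0)`, as a continuous linear form on `H¹(0,1)`. -/
def evalZero : H1 →L[ℝ] ℝ :=
  LinearMap.mkContinuousOfExistsBound
    { toFun := fun u => u.rep 0
      map_add' := fun u v => H1.rep_add u v (left_mem_Icc.2 zero_le_one)
      map_smul' := fun a u => H1.rep_smul a u (left_mem_Icc.2 zero_le_one) } <| by
    have c1 : Continuous fun _ : ℝ => (1 : ℝ) := continuous_const
    have c2 : Continuous fun x : ℝ => x - 1 := by fun_prop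
    refine ⟨‖(memLp_of_continuous c1).toLp (fun _ => (1 : ℝ))‖ +
      ‖(memLp_of_continuous c2).toLp (fun x => x - 1)‖, fun u => ?_⟩
    have e1 : ∫ x, u.fn x ∂μI = ∫ x, u.fn x * 1 ∂μI := by simp
    change ‖u.rep 0‖ ≤ _
    rw [u.rep_zero, e1, integral_mul_eq_inner u.fn c1, integral_mul_eq_inner u.der c2, add_mul]
    have n1 : ‖u.fn‖ ≤ ‖u‖ := WithLp.norm_fst_le (p := 2) (x := u.1)
    have n2 : ‖u.der‖ ≤ ‖u‖ := WithLp.norm_snd_le (p := 2) (x := u.1)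
    refine (norm_add_le _ _).trans (add_le_add ?_ ?_)
    · exact (norm_inner_le_norm _ _).trans (by gcongr)
    · exact (norm_inner_le_norm _ _).trans (by gcongr)


/-- `u` belongs to `H²(0,1)`, its second derivative is `w`, and `u_x(0) = a`, `u_x(1) = b`. -/
def HasLaplacian (u : H1) (w : L2) (a b : ℝ) : Prop :=
  ∃ v : H1, v.fn = u.der ∧ v.der = w ∧ v.rep 0 = a ∧ v.rep 1 = b

theorem HasLaplacian.unique {u : H1} {w w' : L2} {a b a' b' : ℝ} (h : HasLaplacian u w a b)
    (h' : HasLaplacian u w' a' b') : w = w' := by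
  obtain ⟨v, h1, h2, -, -⟩ := h
  obtain ⟨v', h1', h2', -, -⟩ := h'
  have : v = v' := H1.ext_fn (h1.trans h1'.symm)
  rw [← h2, ← h2', this]

theorem HasLaplacian.add {u u' : H1} {w w' : L2} (h : HasLaplacian u w 0 0)
    (h' : HasLaplacian u' w' 0 0) : HasLaplacian (u + u') (w + w') 0 0 := by
  obtain ⟨v, h1, h2, h3, h4⟩ := h
  obtain ⟨v', h1', h2', h3', h4'⟩ := h'
  refine ⟨v + v', congrArg₂ (· + ·) h1 h1', congrArg₂ (· + ·) h2 h2', ?_, ?_⟩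
  · refine (H1.rep_add v v' (left_mem_Icc.2 zero_le_one)).trans ?_
    simp only [h3, h3', add_zero]
  · refine (H1.rep_add v v' (right_mem_Icc.2 zero_le_one)).trans ?_
    simp only [h4, h4', add_zero]

theorem HasLaplacian.smul (a : ℝ) {u : H1} {w : L2} (h : HasLaplacian u w 0 0) :
    HasLaplacian (a • u) (a • w) 0 0 := by
  obtain ⟨v, h1, h2, h3, h4⟩ := h
  refine ⟨a • v, congrArg (a • ·) h1, congrArg (a • ·) h2, ?_, ?_⟩
  · refine (H1.rep_smul a v (left_mem_Icc.2 zero_le_one)).trans ?_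
    simp only [h3, mul_zero]
  · refine (H1.rep_smul a v (right_mem_Icc.2 zero_le_one)).trans ?_
    simp only [h4, mul_zero]

theorem HasLaplacian.zero : HasLaplacian 0 0 0 0 :=
  ⟨0, rfl, rfl, H1.rep_zero_apply (left_mem_Icc.2 zero_le_one),
    H1.rep_zero_apply (right_mem_Icc.2 zero_le_one)⟩

/-- The Neumann Laplacian `u ↦ u''` as an unbounded operator in `H¹(0,1)`. Its domain consists of
the `u ∈ H²(0,1)` with `u_x(0) = u_x(1) = 0` and `u'' ∈ H¹(0,1)`. -/
def neumannLaplacian : H1 →ₗ.[ℝ] H1 where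
  domain :=
    { carrier := {u | ∃ w : H1, HasLaplacian u w.fn 0 0}
      zero_mem' := ⟨0, HasLaplacian.zero⟩
      add_mem' := fun ⟨w, h⟩ ⟨w', h'⟩ => ⟨w + w', h.add h'⟩
      smul_mem' := fun a _ ⟨w, h⟩ => ⟨a • w, h.smul a⟩ }
  toFun :=
    { toFun := fun u => u.2.choose
      map_add' := fun u v => H1.ext_fn <|
        (u + v).2.choose_spec.unique (u.2.choose_spec.add v.2.choose_spec)
      map_smul' := fun a u => H1.ext_fn <|
        (a • u).2.choose_spec.unique (u.2.choose_spec.smul a) }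

theorem neumannLaplacian_spec (u : neumannLaplacian.domain) :
    HasLaplacian (u : H1) (neumannLaplacian u).fn 0 0 := u.2.choose_spec

theorem neumannLaplacian_eq {u : neumannLaplacian.domain} {w : H1}
    (h : HasLaplacian (u : H1) w.fn 0 0) : neumannLaplacian u = w :=
  H1.ext_fn ((neumannLaplacian_spec u).unique h)

/-- `λ_n = π² n²`. -/
def eigval (n : ℕ) : ℝ := Real.pi ^ 2 * (n : ℝ) ^ 2

/-- The constants normalizing `cos (nπ ·)` in `H¹(0,1)`. -/
def normConst (n : ℕ) : ℝ := if n = 0 then 1 else √(2 / (1 + Real.pi ^ 2 * (n : ℝ) ^ 2))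

/-- The eigenfunction `φ_n(x) = A_n cos (nπx)` of the Neumann Laplacian. -/
def eigfun (n : ℕ) : H1 :=
  H1.ofC1 (fun x => normConst n * Real.cos (n * Real.pi * x))
    (fun x => normConst n * (-Real.sin (n * Real.pi * x) * (n * Real.pi)))
    (fun x => ((Real.hasDerivAt_cos _).comp x
      (((hasDerivAt_id x).const_mul ((n : ℝ) * Real.pi)).congr_deriv (mul_one _))).const_mul _)
    (by fun_prop)

theorem eigfun_hasLaplacian (n : ℕ) :
    HasLaplacian (eigfun n) (-eigval n • eigfun n : H1).fn 0 0 := by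
  have hcs : Continuous fun x : ℝ => normConst n * (-Real.sin (n * Real.pi * x) * (n * Real.pi)) := by
    fun_prop
  have hcc : Continuous fun x : ℝ => normConst n * Real.cos (n * Real.pi * x) := by fun_prop
  set v : H1 := H1.ofC1 (fun x => normConst n * (-Real.sin (n * Real.pi * x) * (n * Real.pi)))
    (fun x => -eigval n * (normConst n * Real.cos (n * Real.pi * x)))
    (fun x => by
      have h : HasDerivAt (fun y : ℝ => Real.sin (n * Real.pi * y))
          (Real.cos (n * Real.pi * x) * (n * Real.pi)) x :=
        (Real.hasDerivAt_sin _).comp x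
          (((hasDerivAt_id x).const_mul ((n : ℝ) * Real.pi)).congr_deriv (mul_one _))
      refine ((h.neg.mul_const (n * Real.pi)).const_mul (normConst n)).congr_deriv ?_
      simp only [eigval]; ring) (by fun_prop) with hv
  have hrep : EqOn v.rep (fun x => normConst n * (-Real.sin (n * Real.pi * x) * (n * Real.pi)))
      (Icc 0 1) := by
    refine v.rep_unique hcs.continuousOn ?_
    exact (memLp_of_continuous hcs).coeFn_toLp
  refine ⟨v, rfl, ?_, ?_, ?_⟩
  · change (memLp_of_continuous (continuous_const.mul hcc)).toLp
      (fun x => -eigval n * (normConst n * Real.cos (n * Real.pi * x))) =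
      -eigval n • (memLp_of_continuous hcc).toLp _
    rw [← MemLp.toLp_const_smul]
    rfl
  · rw [hrep (left_mem_Icc.2 zero_le_one)]; simp
  · rw [hrep (right_mem_Icc.2 zero_le_one)]; simp [Real.sin_nat_mul_pi]

theorem eigfun_mem (n : ℕ) : eigfun n ∈ neumannLaplacian.domain := ⟨_, eigfun_hasLaplacian n⟩

/-- The state space `𝓗 = ℝ^d × ℝ × H¹(0,1)`, the Hilbert sum of the three factors. -/
def State (d : ℕ) : Type := WithLp 2 (EuclideanSpace ℝ (Fin d) × WithLp 2 (ℝ × H1))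

instance (d : ℕ) : NormedAddCommGroup (State d) :=
  inferInstanceAs (NormedAddCommGroup (WithLp 2 (EuclideanSpace ℝ (Fin d) × WithLp 2 (ℝ × H1))))

instance (d : ℕ) : InnerProductSpace ℝ (State d) :=
  inferInstanceAs (InnerProductSpace ℝ (WithLp 2 (EuclideanSpace ℝ (Fin d) × WithLp 2 (ℝ × H1))))

instance (d : ℕ) : CompleteSpace (State d) :=
  inferInstanceAs (CompleteSpace (WithLp 2 (EuclideanSpace ℝ (Fin d) × WithLp 2 (ℝ × H1))))

section Operators

variable {d : ℕ}

/-- The component `X` of `Z = (X, Y, z)`. -/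
def prX : State d →L[ℝ] EuclideanSpace ℝ (Fin d) :=
  WithLp.fstL 2 ℝ (EuclideanSpace ℝ (Fin d)) (WithLp 2 (ℝ × H1))

/-- The component `Y` of `Z = (X, Y, z)`. -/
def prY : State d →L[ℝ] ℝ :=
  WithLp.fstL 2 ℝ ℝ H1 ∘L WithLp.sndL 2 ℝ (EuclideanSpace ℝ (Fin d)) (WithLp 2 (ℝ × H1))

/-- The component `z` of `Z = (X, Y, z)`. -/
def prZ : State d →L[ℝ] H1 :=
  WithLp.sndL 2 ℝ ℝ H1 ∘L WithLp.sndL 2 ℝ (EuclideanSpace ℝ (Fin d)) (WithLp 2 (ℝ × H1))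

/-- The operator into `𝓗` with the three given components. -/
def col {W : Type} [NormedAddCommGroup W] [NormedSpace ℝ W] (f : W →L[ℝ] EuclideanSpace ℝ (Fin d))
    (g : W →L[ℝ] ℝ) (h : W →L[ℝ] H1) : W →L[ℝ] State d :=
  (WithLp.prodContinuousLinearEquiv 2 ℝ (EuclideanSpace ℝ (Fin d))
      (WithLp 2 (ℝ × H1))).symm.toContinuousLinearMap ∘L
    f.prod ((WithLp.prodContinuousLinearEquiv 2 ℝ ℝ H1).symm.toContinuousLinearMap ∘L g.prod h)

/-- The operator `Δ̃ = diag(0, 0, Δ)`, an unbounded operator in `𝓗`. -/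
def deltaT (d : ℕ) : State d →ₗ.[ℝ] State d where
  domain := neumannLaplacian.domain.comap (prZ (d := d)).toLinearMap
  toFun := (col (d := d) 0 0 (ContinuousLinearMap.id ℝ H1)).toLinearMap ∘ₗ
    neumannLaplacian.toFun ∘ₗ
      ((prZ (d := d)).toLinearMap.restrict fun _ h => h)

/-- The operator `Ã`. -/
def aT (A : Matrix (Fin d) (Fin d) ℝ) (B : EuclideanSpace ℝ (Fin d)) (c μ : ℝ) (ρ : H1) :
    State d →L[ℝ] State d :=
  col (Matrix.toEuclideanCLM (𝕜 := ℝ) A ∘L prX - ρ.rep 0 • prY.smulRight B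
      + (evalZero ∘L prZ).smulRight B)
    (μ • prY)
    (c • prZ)

/-- The operator `C̃`. -/
def cT (C : Matrix (Fin d) (Fin d) ℝ) (D : EuclideanSpace ℝ (Fin d)) (ρ : H1) :
    State d →L[ℝ] State d :=
  col (Matrix.toEuclideanCLM (𝕜 := ℝ) C ∘L prX - ρ.rep 0 • prY.smulRight D
      + (evalZero ∘L prZ).smulRight D)
    0
    0

/-- The operator `B̃ : ℝ → 𝓗`, `v ↦ v (0, 1, -ρ)`. -/
def bT (d : ℕ) (ρ : H1) : ℝ →L[ℝ] State d :=
  col 0 (ContinuousLinearMap.id ℝ ℝ) (-ContinuousLinearMap.toSpanSingleton ℝ ρ)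

/-- The operator `Q̃ = diag(Q, r, 0)`. -/
def qT (Q : Matrix (Fin d) (Fin d) ℝ) (r : ℝ) : State d →L[ℝ] State d :=
  col (Matrix.toEuclideanCLM (𝕜 := ℝ) Q ∘L prX) (r • prY) 0

/-- The operator `G̃ = diag(G, 0, 0)`. -/
def gT (G : Matrix (Fin d) (Fin d) ℝ) : State d →L[ℝ] State d :=
  col (Matrix.toEuclideanCLM (𝕜 := ℝ) G ∘L prX) 0 0

end Operators

/-- `ρ` solves `-ρ'' + (μ - c) ρ = 0` on `(0,1)` with `ρ_x(0) = 0` and `ρ_x(1) = 1`. -/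
def IsLifting (c μ : ℝ) (ρ : H1) : Prop :=
  ∃ w : L2, HasLaplacian ρ w 0 1 ∧ -w + (μ - c) • ρ.fn = 0

/-- `S` is a strongly continuous semigroup on `H` with infinitesimal generator `L`. -/
structure IsSemigroupGeneratedBy {H : Type} [NormedAddCommGroup H] [NormedSpace ℝ H]
    (S : ℝ → H →L[ℝ] H) (L : H →ₗ.[ℝ] H) : Prop where
  map_zero : S 0 = ContinuousLinearMap.id ℝ H
  map_add : ∀ s t : ℝ, 0 ≤ s → 0 ≤ t → S (s + t) = S s ∘L S t
  continuous : ∀ Z : H, ContinuousOn (fun t => S t Z) (Ici 0)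
  generator : ∀ Z W : H,
    Tendsto (fun t : ℝ => t⁻¹ • (S t Z - Z)) (𝓝[>] 0) (𝓝 W) ↔ (Z, W) ∈ L.graph

/-- `H¹_N = span(φ_0, …, φ_N)`. -/
def H1N (N : ℕ) : Submodule ℝ H1 := Submodule.span ℝ (eigfun '' Iic N)

/-- `𝓗_N = ℝ^d × ℝ × H¹_N`, a subspace of `𝓗`. -/
def HN (d N : ℕ) : Submodule ℝ (State d) := (H1N N).comap (prZ (d := d)).toLinearMap

instance (N : ℕ) : FiniteDimensional ℝ (H1N N) :=
  FiniteDimensional.span_of_finite ℝ ((finite_Iic N).image _)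

instance (d N : ℕ) : FiniteDimensional ℝ (HN d N) := by
  let f : HN d N →ₗ[ℝ] EuclideanSpace ℝ (Fin d) × ℝ × H1N N :=
    ((prX (d := d)).toLinearMap ∘ₗ (HN d N).subtype).prod
      (((prY (d := d)).toLinearMap ∘ₗ (HN d N).subtype).prod
        ((prZ (d := d)).toLinearMap.restrict fun _ h => h))
  refine FiniteDimensional.of_injective f fun a b h => ?_
  have h1 := congrArg Prod.fst h
  have h2 := congrArg (fun p => p.2.1) h
  have h3 := congrArg (fun p => (p.2.2 : H1)) h
  exact Subtype.ext (WithLp.ofLp_injective 2 (Prod.ext h1 (WithLp.ofLp_injective 2 (Prod.ext h2 h3))))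

instance (d N : ℕ) : CompleteSpace (HN d N) := FiniteDimensional.complete ℝ _

/-- The orthogonal projection `P_N` of `𝓗` onto `𝓗_N`. -/
def projN (d N : ℕ) : State d →L[ℝ] HN d N := (HN d N).orthogonalProjectionOnto

/-- The adjoint `P_N^* : 𝓗_N → 𝓗` of the projection. -/
def projNadj (d N : ℕ) : HN d N →L[ℝ] State d := ContinuousLinearMap.adjoint (projN d N)

theorem projNadj_apply (d N : ℕ) (Z : HN d N) : projNadj d N Z = (Z : State d) := by
  rw [projNadj, projN, Submodule.adjoint_orthogonalProjectionOnto]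
  rfl

theorem projNadj_mem (d N : ℕ) (Z : HN d N) : projNadj d N Z ∈ (deltaT d).domain := by
  rw [projNadj_apply]
  have : H1N N ≤ neumannLaplacian.domain := by
    rw [H1N, Submodule.span_le]
    rintro _ ⟨n, -, rfl⟩
    exact eigfun_mem n
  exact this Z.2

/-- The operator `Δ̃_N = P_N Δ̃ P_N^*` on the finite-dimensional space `𝓗_N`. -/
def deltaN (d N : ℕ) : HN d N →L[ℝ] HN d N :=
  LinearMap.toContinuousLinearMap
    ((projN d N).toLinearMap ∘ₗ (deltaT d).toFun ∘ₗ
      ((projNadj d N).toLinearMap.codRestrict (deltaT d).domain (projNadj_mem d N)))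

/-- The compression `P_N M P_N^*` of a bounded operator `M` on `𝓗`. -/
def compress {d : ℕ} (N : ℕ) (M : State d →L[ℝ] State d) : HN d N →L[ℝ] HN d N :=
  projN d N ∘L M ∘L projNadj d N

section Riccati

variable {H : Type} [NormedAddCommGroup H] [InnerProductSpace ℝ H] [CompleteSpace H]

/-- The terms `P A + A^* P + C^* P C + Q - δ⁻¹ P B B^* P` of the Riccati equation. -/
def riccatiTerm (A C Q : H →L[ℝ] H) (B : ℝ →L[ℝ] H) (δ : ℝ) (P : H →L[ℝ] H) : H →L[ℝ] H :=
  P ∘L A + ContinuousLinearMap.adjoint A ∘L P + ContinuousLinearMap.adjoint C ∘L P ∘L C + Q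
    - δ⁻¹ • (P ∘L B ∘L ContinuousLinearMap.adjoint B ∘L P)

/-- `P` is a mild solution on `[0,T]` of the Riccati equation
`P' + P (L + A) + (L^* + A^*) P + C^* P C + Q - δ⁻¹ P B B^* P = 0`, `P(T) = G`,
where `L` is the generator of the semigroup `S`: it is strongly continuous and satisfies the
variation of constants formula. -/
structure IsMildRiccatiSolution (S : ℝ → H →L[ℝ] H) (A C Q G : H →L[ℝ] H) (B : ℝ →L[ℝ] H)
    (δ T : ℝ) (P : ℝ → H →L[ℝ] H) : Prop where
  continuous : ∀ Z : H, ContinuousOn (fun t => P t Z) (Icc 0 T)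
  eq : ∀ t ∈ Icc 0 T, ∀ Z : H,
    P t Z = ContinuousLinearMap.adjoint (S (T - t)) (G (S (T - t) Z)) +
      ∫ τ in t..T, ContinuousLinearMap.adjoint (S (τ - t))
        (riccatiTerm A C Q B δ (P τ) (S (τ - t) Z))

/-- `P` is a (classical) solution on `[0,T]` of the Riccati equation
`P' + P (L + A) + (L + A^*) P + C^* P C + Q - δ⁻¹ P B B^* P = 0`, `P(T) = G`,
in which all operators are bounded. -/
structure IsRiccatiSolution (L A C Q G : H →L[ℝ] H) (B : ℝ →L[ℝ] H) (δ T : ℝ)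
    (P : ℝ → H →L[ℝ] H) : Prop where
  deriv : ∀ t ∈ Icc 0 T,
    HasDerivWithinAt P (-(P t ∘L L + L ∘L P t + riccatiTerm A C Q B δ (P t))) (Icc 0 T) t
  terminal : P T = G

end Riccati

end SpectralRiccati

end

open MeasureTheory Set Filter Topology
open scoped RealInnerProductSpace

namespace SpectralRiccati

/-! ### Uniform bounds, a Gronwall inequality and perturbation of Riccati terms -/

section Abstract

variable {H : Type} [NormedAddCommGroup H] [InnerProductSpace ℝ H]

/-! The convergence holds in operator norm, uniformly in time; the vector `Z` enters only at the
very end. Let `p = P_N^* P_N` and lift the Galerkin solution to `Y = P_N^* Π_N P_N`. The cosines are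
eigenvectors of the Neumann Laplacian and form an orthogonal total family of `H¹(0,1)`, so `P_N`
intertwines `S(s)` with `exp(s Δ̃_N)` (`comp_eq_exp_comp`). Hence `Y` satisfies a mild equation with
the same semigroup `S` as `Π` (`IsRiccatiSolution.lift_eq_integral`), and only the bounded
coefficients have to be compared.

These differ very little. `Q̃` and `G̃` are unchanged by compression with `p`, and `B̃` needs no
approximation because `Y p = Y = p Y`. What remains is `p Ã (1 - p)` and `C̃ (1 - p)`. Vectors in
the range of `1 - p` have no component in `ℝ^d × ℝ`, so both operators are of rank at most one: a
fixed vector (up to `p`) times the form `γ_0^*` composed with `1 - p`. By Riesz representation the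
norm of this form is the distance from its representing vector to `𝓗_N`, which tends to zero
(`tendsto_norm_comp_one_sub`).

The difference of the Riccati terms is thus Lipschitz in `Π - Y` up to a vanishing error
(`norm_riccatiTerm_sub_le`), and Gronwall's inequality bounds `‖Π - Y‖` as long as `‖Y‖ ≤ M + 1`,
where `M` bounds `‖Π‖` on `[0,T]`. Once the Gronwall bound is below `1` it gives `‖Y‖ < M + 1`, so a
continuity argument backwards from `Y(T) = G̃ = Π(T)` keeps `Y` in this range on all of `[0,T]`
(`exists_tendsto_zero_norm_sub_lift_le`). -/

theorem exists_norm_le_of_continuousOn_apply [CompleteSpace H] {P : ℝ → H →L[ℝ] H} {a b : ℝ}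
    (h : ∀ Z, ContinuousOn (fun t => P t Z) (Icc a b)) :
    ∃ M, 0 ≤ M ∧ ∀ t ∈ Icc a b, ‖P t‖ ≤ M := by
  obtain ⟨M, hM⟩ := banach_steinhaus (g := fun t : Icc a b => P t) fun Z => by
    obtain ⟨C, hC⟩ := isCompact_Icc.exists_bound_of_continuousOn (h Z)
    exact ⟨C, fun t => hC t t.2⟩
  exact ⟨max M 0, le_max_right _ _, fun t ht => (hM ⟨t, ht⟩).trans (le_max_left _ _)⟩

/-- Split `P u (z u)` into `P u (z u - z t)`, small by the uniform bound, and `P u (z t)`, handled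
by strong continuity. -/
theorem continuousOn_apply_of_norm_le {P : ℝ → H →L[ℝ] H} {s : Set ℝ} {M : ℝ}
    (hM : ∀ t ∈ s, ‖P t‖ ≤ M) (h : ∀ Z, ContinuousOn (fun t => P t Z) s) {z : ℝ → H}
    (hz : ContinuousOn z s) : ContinuousOn (fun t => P t (z t)) s := by
  intro t ht
  have h1 : Tendsto (fun u => P u (z u - z t)) (𝓝[s] t) (𝓝 0) := by
    have h2 : Tendsto (fun u => M * ‖z u - z t‖) (𝓝[s] t) (𝓝 0) := by
      have := ((hz t ht).sub_const (z t)).norm.const_mul M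
      simpa using this
    refine squeeze_zero_norm' ?_ h2
    filter_upwards [self_mem_nhdsWithin] with u hu
    exact (P u).le_of_opNorm_le (hM u hu) _
  have h3 := h1.add (h (z t) t ht)
  simp only [map_sub, sub_add_cancel, zero_add] at h3
  exact h3

/-- Gronwall by a weighted supremum: with the weight `exp (2 L (T - t))` the integral term
contributes at most half of the weighted supremum of `e`. The integral is taken of continuous
majorants `β` because the intended `e`, the norm of a strongly continuous family, is not known to be
continuous. -/
theorem le_of_integral_inequality {e : ℝ → ℝ} {I : Set ℝ} {T K L ε : ℝ}
    (hI : ∀ t ∈ I, t ≤ T ∧ Icc t T ⊆ I) (hL : 0 < L) (hε : 0 ≤ ε)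
    (hK : ∀ t ∈ I, e t ≤ K)
    (h : ∀ t ∈ I, ∀ β : ℝ → ℝ, Continuous β → (∀ τ ∈ Icc t T, e τ ≤ β τ) →
      e t ≤ ε + L * ∫ τ in t..T, β τ) :
    ∀ t ∈ I, e t ≤ 2 * ε * Real.exp (2 * L * (T - t)) := by
  intro t ht
  set w : ℝ → ℝ := fun τ => Real.exp (2 * L * (T - τ)) with hw
  have hwc : Continuous w := by fun_prop
  have hw0 : ∀ τ, 0 < w τ := fun τ => Real.exp_pos _
  have hw1 : ∀ τ ∈ I, 1 ≤ w τ := fun τ hτ =>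
    Real.one_le_exp (mul_nonneg (by linarith) (by linarith [(hI τ hτ).1]))
  set s : Set ℝ := (fun τ => e τ / w τ) '' I with hs
  -- The crude bound `K` serves only to make the weighted supremum finite.
  have hsb : BddAbove s := by
    refine ⟨max K 0, ?_⟩
    rintro _ ⟨τ, hτ, rfl⟩
    rw [div_le_iff₀ (hw0 τ)]
    exact ((hK τ hτ).trans (le_max_left _ _)).trans
      (le_mul_of_one_le_right (le_max_right _ _) (hw1 τ hτ))
  set m := max (sSup s) 0 with hm
  have hem : ∀ τ ∈ I, e τ ≤ m * w τ := fun τ hτ => by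
    rw [← div_le_iff₀ (hw0 τ)]
    exact (le_csSup hsb ⟨τ, hτ, rfl⟩).trans (le_max_left _ _)
  have hint : ∀ τ, ∫ u in τ..T, m * w u = m * ((w τ - 1) / (2 * L)) := fun τ => by
    rw [intervalIntegral.integral_const_mul]
    congr 1
    have hd : ∀ u ∈ uIcc τ T, HasDerivAt (fun u => -(w u / (2 * L))) (w u) u := fun u _ => by
      have h1 : HasDerivAt (fun u : ℝ => 2 * L * (T - u)) (2 * L * (-1)) u :=
        ((hasDerivAt_id u).const_sub T).const_mul _
      refine ((h1.exp.div_const (2 * L)).neg).congr_deriv ?_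
      field_simp
      simp [hw]
    rw [intervalIntegral.integral_eq_sub_of_hasDerivAt hd (hwc.intervalIntegrable _ _)]
    simp only [hw, sub_self, mul_zero, Real.exp_zero]
    ring
  have hkey : ∀ τ ∈ I, e τ / w τ ≤ ε + m / 2 := fun τ hτ => by
    have h1 := h τ hτ (fun u => m * w u) (by fun_prop)
      fun u hu => hem u ((hI τ hτ).2 hu)
    rw [hint] at h1
    rw [div_le_iff₀ (hw0 τ)]
    have h2 : L * (m * ((w τ - 1) / (2 * L))) = m / 2 * (w τ - 1) := by field_simp
    have h3 : ε ≤ ε * w τ := le_mul_of_one_le_right hε (hw1 τ hτ)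
    have h4 : 0 ≤ m := le_max_right _ _
    rw [h2] at h1
    nlinarith
  -- Absorbing `m / 2` gives `m ≤ 2 * ε`, the source of the factor 2 in the conclusion.
  have hm2 : m ≤ ε + m / 2 := by
    refine max_le (csSup_le ⟨_, t, ht, rfl⟩ ?_) ?_
    · rintro _ ⟨τ, hτ, rfl⟩
      exact hkey τ hτ
    · have : 0 ≤ m := le_max_right _ _
      linarith
  refine (hem t ht).trans (mul_le_mul_of_nonneg_right (by linarith) (hw0 t).le)

variable [CompleteSpace H]

/-- The difference splits into terms containing `X - Y`, which give the Lipschitz part, and terms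
containing `a = p A (1 - p)`, `k = C (1 - p)` or their adjoints, which give the consistency error.
The identities `Y p = Y = p Y` are what put a `p` in front of `A (1 - p)`. -/
theorem norm_riccatiTerm_sub_le (A C Q X Y p : H →L[ℝ] H) (B : ℝ →L[ℝ] H) (δ : ℝ)
    (hp : IsSelfAdjoint p) (hp1 : ‖p‖ ≤ 1) (hQ : p ∘L Q ∘L p = Q) (hYp : Y ∘L p = Y)
    (hpY : p ∘L Y = Y) :
    ‖riccatiTerm A C Q B δ X - (Y ∘L A ∘L p + p ∘L ContinuousLinearMap.adjoint A ∘L Y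
        + p ∘L ContinuousLinearMap.adjoint C ∘L Y ∘L C ∘L p + p ∘L Q ∘L p
        - δ⁻¹ • (Y ∘L B ∘L ContinuousLinearMap.adjoint B ∘L Y))‖ ≤
      (2 * ‖A‖ + ‖C‖ ^ 2 + |δ⁻¹| * ‖B‖ ^ 2 * (‖X‖ + ‖Y‖)) * ‖X - Y‖ +
        2 * ‖Y‖ * (‖p ∘L A ∘L (1 - p)‖ + ‖C‖ * ‖C ∘L (1 - p)‖) := by
  set BB : H →L[ℝ] H := B ∘L ContinuousLinearMap.adjoint B with hBB
  have hBBn : ‖BB‖ ≤ ‖B‖ ^ 2 := by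
    refine (ContinuousLinearMap.opNorm_comp_le _ _).trans ?_
    rw [LinearIsometryEquiv.norm_map, sq]
  set a : H →L[ℝ] H := p * A * (1 - p) with ha
  set k : H →L[ℝ] H := C * (1 - p) with hk
  have han : ‖p ∘L A ∘L (1 - p)‖ = ‖a‖ := by
    rw [ha, mul_assoc]; rfl
  have hkn : ‖C ∘L (1 - p)‖ = ‖k‖ := rfl
  have hps : star p = p := hp
  have hsa : star a = (1 - p) * star A * p := by
    rw [ha]; simp [star_mul, hps, mul_assoc]
  have hsk : star k = (1 - p) * star C := by
    rw [hk]; simp [star_mul, hps]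
  have hY1 : Y * p = Y := hYp
  have hY2 : p * Y = Y := hpY
  have e : riccatiTerm A C Q B δ X - (Y ∘L A ∘L p + p ∘L ContinuousLinearMap.adjoint A ∘L Y
        + p ∘L ContinuousLinearMap.adjoint C ∘L Y ∘L C ∘L p + p ∘L Q ∘L p
        - δ⁻¹ • (Y ∘L B ∘L ContinuousLinearMap.adjoint B ∘L Y)) =
      (X - Y) * A + Y * a + star A * (X - Y) + star a * Y + star C * (X - Y) * C
        + star C * Y * k + star k * Y * C * p
        - δ⁻¹ • ((X - Y) * BB * X + Y * BB * (X - Y)) := by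
    rw [hQ, hsa, hsk, ha, hk]
    have e1 : Y * (p * A * (1 - p)) = Y * A - Y * A * p := by
      rw [← mul_assoc, ← mul_assoc, hY1]; noncomm_ring
    have e2 : (1 - p) * star A * p * Y = star A * Y - p * star A * Y := by
      rw [mul_assoc, hY2]; noncomm_ring
    rw [e1, e2]
    have e3 : riccatiTerm A C Q B δ X = X * A + star A * X + star C * X * C + Q
        - δ⁻¹ • (X * BB * X) := rfl
    have e4 : Y ∘L A ∘L p + p ∘L ContinuousLinearMap.adjoint A ∘L Y
        + p ∘L ContinuousLinearMap.adjoint C ∘L Y ∘L C ∘L p + Q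
        - δ⁻¹ • (Y ∘L B ∘L ContinuousLinearMap.adjoint B ∘L Y) =
        Y * A * p + p * star A * Y + p * star C * Y * C * p + Q - δ⁻¹ • (Y * BB * Y) := rfl
    rw [e3, e4]
    have e5 : (X - Y) * BB * X + Y * BB * (X - Y) = X * BB * X - Y * BB * Y := by noncomm_ring
    rw [e5, smul_sub]
    noncomm_ring
  rw [e, han, hkn]
  have n2 : ∀ U V : H →L[ℝ] H, ‖U * V‖ ≤ ‖U‖ * ‖V‖ := norm_mul_le
  have n3 : ∀ U V W : H →L[ℝ] H, ‖U * V * W‖ ≤ ‖U‖ * ‖V‖ * ‖W‖ := fun U V W =>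
    (n2 _ _).trans (by gcongr; exact n2 _ _)
  have ns : ∀ U : H →L[ℝ] H, ‖star U‖ = ‖U‖ := LinearIsometryEquiv.norm_map _
  have b1 := n2 (X - Y) A
  have b2 := n2 Y a
  have b3 := n2 (star A) (X - Y)
  have b4 := n2 (star a) Y
  have b5 := n3 (star C) (X - Y) C
  have b6 := n3 (star C) Y k
  have b7 : ‖star k * Y * C * p‖ ≤ ‖k‖ * ‖Y‖ * ‖C‖ := by
    refine (n2 _ _).trans ((mul_le_of_le_one_right (norm_nonneg _) hp1).trans ?_)
    have := n3 (star k) Y C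
    rwa [ns] at this
  have b8 : ‖δ⁻¹ • ((X - Y) * BB * X + Y * BB * (X - Y))‖ ≤
      |δ⁻¹| * (‖X - Y‖ * ‖B‖ ^ 2 * ‖X‖ + ‖Y‖ * ‖B‖ ^ 2 * ‖X - Y‖) := by
    rw [norm_smul, Real.norm_eq_abs]
    refine mul_le_mul_of_nonneg_left ((norm_add_le _ _).trans (add_le_add ?_ ?_)) (abs_nonneg _)
    · exact (n3 _ _ _).trans (by gcongr)
    · exact (n3 _ _ _).trans (by gcongr)
  rw [ns] at b3 b4 b5 b6
  refine (norm_sub_le _ _).trans ?_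
  have c1 := norm_add_le ((X - Y) * A) (Y * a)
  have c2 := norm_add_le ((X - Y) * A + Y * a) (star A * (X - Y))
  have c3 := norm_add_le ((X - Y) * A + Y * a + star A * (X - Y)) (star a * Y)
  have c4 := norm_add_le ((X - Y) * A + Y * a + star A * (X - Y) + star a * Y)
    (star C * (X - Y) * C)
  have c5 := norm_add_le ((X - Y) * A + Y * a + star A * (X - Y) + star a * Y
    + star C * (X - Y) * C) (star C * Y * k)
  have c6 := norm_add_le ((X - Y) * A + Y * a + star A * (X - Y) + star a * Y
    + star C * (X - Y) * C + star C * Y * k) (star k * Y * C * p)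
  linarith

variable {K : Type} [NormedAddCommGroup K] [InnerProductSpace ℝ K] [CompleteSpace K]

theorem continuous_riccatiTerm (A C Q : K →L[ℝ] K) (B : ℝ →L[ℝ] K) (δ : ℝ) :
    Continuous (riccatiTerm A C Q B δ) := by
  unfold riccatiTerm
  fun_prop

/-- The variation of constants formula for a Riccati equation with bounded coefficients. -/
theorem IsRiccatiSolution.eq_integral {L A C Q G : K →L[ℝ] K} {B : ℝ →L[ℝ] K} {δ T : ℝ}
    {X : ℝ → K →L[ℝ] K} (h : IsRiccatiSolution L A C Q G B δ T X) {t : ℝ} (ht : t ∈ Icc 0 T) :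
    IntervalIntegrable (fun τ => NormedSpace.exp ((τ - t) • L) *
        riccatiTerm A C Q B δ (X τ) * NormedSpace.exp ((τ - t) • L)) volume t T ∧
    X t = NormedSpace.exp ((T - t) • L) * G * NormedSpace.exp ((T - t) • L) +
      ∫ τ in t..T, NormedSpace.exp ((τ - t) • L) * riccatiTerm A C Q B δ (X τ) *
        NormedSpace.exp ((τ - t) • L) := by
  have hsub : Icc t T ⊆ Icc 0 T := Icc_subset_Icc_left ht.1
  have hX : ContinuousOn X (Icc t T) := fun τ hτ =>
    ((h.deriv τ (hsub hτ)).continuousWithinAt).mono hsub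
  have he : ∀ τ, HasDerivAt (fun τ => NormedSpace.exp ((τ - t) • L))
      (L * NormedSpace.exp ((τ - t) • L)) τ := fun τ => by
    have h1 := (hasDerivAt_exp_smul_const' (𝕂 := ℝ) L (τ - t)).scomp τ
      ((hasDerivAt_id τ).sub_const t)
    exact h1.congr_deriv (one_smul _ _)
  have he' : ∀ τ, L * NormedSpace.exp ((τ - t) • L) = NormedSpace.exp ((τ - t) • L) * L :=
    fun τ => (hasDerivAt_exp_smul_const' (𝕂 := ℝ) L (τ - t)).unique
      (hasDerivAt_exp_smul_const (𝕂 := ℝ) L (τ - t))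
  have hec : Continuous fun τ => NormedSpace.exp ((τ - t) • L) :=
    continuous_iff_continuousAt.2 fun τ => (he τ).continuousAt
  have hF : ContinuousOn (fun τ => riccatiTerm A C Q B δ (X τ)) (Icc t T) :=
    (continuous_riccatiTerm A C Q B δ).comp_continuousOn hX
  have hint : IntervalIntegrable (fun τ => NormedSpace.exp ((τ - t) • L) *
      riccatiTerm A C Q B δ (X τ) * NormedSpace.exp ((τ - t) • L)) volume t T := by
    refine ContinuousOn.intervalIntegrable_of_Icc ht.2 ?_
    exact (hec.continuousOn.mul hF).mul hec.continuousOn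
  refine ⟨hint, ?_⟩
  -- With `V = exp ((τ - t) L)`, the linear terms of the equation cancel in the derivative of `-(V X
  -- V)`, leaving exactly the integrand.
  have hftc := intervalIntegral.integral_eq_sub_of_hasDerivAt_of_le ht.2
    (f := fun τ => -(NormedSpace.exp ((τ - t) • L) * X τ * NormedSpace.exp ((τ - t) • L)))
    ((hec.continuousOn.mul hX).mul hec.continuousOn).neg ?_ hint
  · rw [hftc]
    simp [h.terminal]
  · intro τ hτ
    have hXd := (h.deriv τ (hsub (Ioo_subset_Icc_self hτ))).hasDerivAt
      (Icc_mem_nhds (ht.1.trans_lt hτ.1) hτ.2)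
    refine (((he τ).mul hXd).mul (he τ)).neg.congr_deriv ?_
    change -((L * NormedSpace.exp ((τ - t) • L) * X τ + NormedSpace.exp ((τ - t) • L) *
      -(X τ * L + L * X τ + riccatiTerm A C Q B δ (X τ))) * NormedSpace.exp ((τ - t) • L) +
      NormedSpace.exp ((τ - t) • L) * X τ * (L * NormedSpace.exp ((τ - t) • L))) = _
    have hcomm : L * NormedSpace.exp ((τ - t) • L) * X τ =
        NormedSpace.exp ((τ - t) • L) * L * X τ := by rw [he' τ]
    rw [hcomm]
    generalize NormedSpace.exp ((τ - t) • L) = V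
    noncomm_ring

end Abstract

/-- A continuity argument, going backwards from the terminal time. -/
theorem le_of_continuousOn_of_forall_lt {f : ℝ → ℝ} {T b : ℝ} (hf : ContinuousOn f (Icc 0 T))
    (hT : f T ≤ b) (h : ∀ t ∈ Icc 0 T, (∀ τ ∈ Icc t T, f τ ≤ b) → f t < b) :
    ∀ t ∈ Icc 0 T, f t ≤ b := by
  intro t ht
  by_contra! hlt
  have hft : ContinuousOn f (Icc t T) := hf.mono (Icc_subset_Icc_left ht.1)
  -- Let `t₁` be the last time at which `f ≥ b`. By the intermediate value theorem `f t₁ = b`, while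
  -- `f ≤ b` afterwards, which contradicts the strict inequality given by `h` at `t₁`.
  set V : Set ℝ := Icc t T ∩ f ⁻¹' Ici b with hV
  have hVc : IsCompact V :=
    isCompact_Icc.of_isClosed_subset (hft.preimage_isClosed_of_isClosed isClosed_Icc isClosed_Ici)
      inter_subset_left
  obtain ⟨t₁, ht₁, hmax⟩ := hVc.exists_isGreatest ⟨t, left_mem_Icc.2 ht.2, hlt.le⟩
  have hsub : Icc t₁ T ⊆ Icc t T := Icc_subset_Icc_left ht₁.1.1
  obtain ⟨τ, hτ, hτb⟩ := intermediate_value_Icc' ht₁.1.2 (hft.mono hsub) ⟨hT, ht₁.2⟩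
  have hτ₁ : τ = t₁ := le_antisymm (hmax ⟨hsub hτ, hτb.ge⟩) hτ.1
  refine (h t₁ ⟨ht.1.trans ht₁.1.1, ht₁.1.2⟩ fun u hu => ?_).ne (hτ₁ ▸ hτb)
  by_contra! hu'
  have := le_antisymm (hmax ⟨hsub hu, hu'.le⟩) hu.1
  rw [this, ← hτ₁, hτb] at hu'
  exact lt_irrefl _ hu'

/-! ### Error of Galerkin approximations of an abstract Riccati equation -/

section Galerkin

variable {H K : Type} [NormedAddCommGroup H] [InnerProductSpace ℝ H] [CompleteSpace H]
  [NormedAddCommGroup K] [InnerProductSpace ℝ K] [CompleteSpace K]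

open ContinuousLinearMap (adjoint)

/-- The variation of constants formula for a Galerkin approximation, in terms of the semigroup on
the whole space. -/
theorem IsRiccatiSolution.lift_eq_integral {L : K →L[ℝ] K} {A C Q G : H →L[ℝ] H} {B : ℝ →L[ℝ] H}
    {δ T : ℝ} {X : ℝ → K →L[ℝ] K} {P : H →L[ℝ] K} {S : ℝ → H →L[ℝ] H}
    (hSP : ∀ s, 0 ≤ s → P ∘L S s = NormedSpace.exp (s • L) ∘L P) (hL : IsSelfAdjoint L)
    (h : IsRiccatiSolution L (P ∘L A ∘L adjoint P) (P ∘L C ∘L adjoint P) (P ∘L Q ∘L adjoint P)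
      (P ∘L G ∘L adjoint P) (P ∘L B) δ T X) {t : ℝ} (ht : t ∈ Icc 0 T) (Z : H)
    {p : H →L[ℝ] H} (hp : p = adjoint P ∘L P) {Y : ℝ → H →L[ℝ] H}
    (hY : Y = fun t => adjoint P ∘L X t ∘L P) {F : ℝ → H →L[ℝ] H}
    (hF : F = fun τ => Y τ ∘L A ∘L p + p ∘L adjoint A ∘L Y τ
        + p ∘L adjoint C ∘L Y τ ∘L C ∘L p + p ∘L Q ∘L p
        - δ⁻¹ • (Y τ ∘L B ∘L adjoint B ∘L Y τ)) :
    IntervalIntegrable (fun τ => adjoint (S (τ - t)) (F τ (S (τ - t) Z))) volume t T ∧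
    Y t Z = adjoint (S (T - t)) ((p ∘L G ∘L p) (S (T - t) Z)) +
      ∫ τ in t..T, adjoint (S (τ - t)) (F τ (S (τ - t) Z)) := by
  obtain ⟨hint, heq⟩ := h.eq_integral ht
  set W : ℝ → K →L[ℝ] K := fun τ => NormedSpace.exp ((τ - t) • L) *
    riccatiTerm (P ∘L A ∘L adjoint P) (P ∘L C ∘L adjoint P) (P ∘L Q ∘L adjoint P) (P ∘L B) δ (X τ) *
      NormedSpace.exp ((τ - t) • L) with hW
  have hPS : ∀ s, 0 ≤ s → ∀ Z, NormedSpace.exp (s • L) (P Z) = P (S s Z) := fun s hs Z =>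
    (congrArg (fun M => M Z) (hSP s hs)).symm
  -- The adjoint of the intertwining relation; self-adjointness of `L` makes the exponential its own
  -- adjoint.
  have hSP' : ∀ s, 0 ≤ s → ∀ Z, adjoint P (NormedSpace.exp (s • L) Z) =
      adjoint (S s) (adjoint P Z) := fun s hs Z => by
    have h1 := congrArg adjoint (hSP s hs)
    have h2 : adjoint (NormedSpace.exp (s • L)) = NormedSpace.exp (s • L) := by
      rw [← ContinuousLinearMap.star_eq_adjoint, NormedSpace.star_exp, star_smul, hL.star_eq]
      simp
    rw [ContinuousLinearMap.adjoint_comp, ContinuousLinearMap.adjoint_comp, h2] at h1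
    exact (congrArg (fun M => M Z) h1).symm
  have hFW : ∀ τ ∈ Icc t T, adjoint P (W τ (P Z)) = adjoint (S (τ - t)) (F τ (S (τ - t) Z)) := by
    intro τ hτ
    have hs : 0 ≤ τ - t := sub_nonneg.2 hτ.1
    have e1 : W τ (P Z) = NormedSpace.exp ((τ - t) • L)
      (riccatiTerm (P ∘L A ∘L adjoint P) (P ∘L C ∘L adjoint P) (P ∘L Q ∘L adjoint P) (P ∘L B) δ
        (X τ) (NormedSpace.exp ((τ - t) • L) (P Z))) := rfl
    rw [e1, hPS _ hs, hSP' _ hs]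
    congr 1
    simp [riccatiTerm, hF, hY, hp, ContinuousLinearMap.adjoint_comp]
  have hint2 : IntervalIntegrable (fun τ => adjoint P (W τ (P Z))) volume t T := by
    have h1 : IntervalIntegrable (fun τ => W τ (P Z)) volume t T :=
      ⟨(ContinuousLinearMap.apply ℝ K (P Z)).integrable_comp hint.1,
        (ContinuousLinearMap.apply ℝ K (P Z)).integrable_comp hint.2⟩
    exact ⟨(adjoint P).integrable_comp h1.1, (adjoint P).integrable_comp h1.2⟩
  have hae : EqOn (fun τ => adjoint P (W τ (P Z)))
      (fun τ => adjoint (S (τ - t)) (F τ (S (τ - t) Z))) (uIcc t T) := by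
    rw [uIcc_of_le ht.2]
    exact hFW
  refine ⟨hint2.congr (hae.mono uIoc_subset_uIcc), ?_⟩
  have e : Y t Z = adjoint P (X t (P Z)) := by rw [hY]; rfl
  rw [e, ← intervalIntegral.integral_congr hae, heq, add_apply, map_add,
    ContinuousLinearMap.intervalIntegral_apply hint]
  congr 1
  · have hs : 0 ≤ T - t := sub_nonneg.2 ht.2
    change adjoint P (NormedSpace.exp ((T - t) • L) (P (G (adjoint P
      (NormedSpace.exp ((T - t) • L) (P Z)))))) = _
    rw [hPS _ hs Z, hSP' _ hs (P _), hp]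
    rfl
  · refine (ContinuousLinearMap.intervalIntegral_comp_comm _ ?_).symm
    exact ⟨(ContinuousLinearMap.apply ℝ K (P Z)).integrable_comp hint.1,
        (ContinuousLinearMap.apply ℝ K (P Z)).integrable_comp hint.2⟩

/-- Strong continuity alone does not pass to adjoints; self-adjointness of `S` replaces `adjoint (S
(τ - t))` by `S (τ - t)`, after which the integrand is continuous. -/
theorem intervalIntegrable_mild_integrand {S Pi : ℝ → H →L[ℝ] H} {A C Q : H →L[ℝ] H}
    {B : ℝ →L[ℝ] H} {δ T M Ms t : ℝ} (hSa : ∀ s, 0 ≤ s → IsSelfAdjoint (S s))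
    (hSc : ∀ Z, ContinuousOn (fun s => S s Z) (Ici 0)) (hSM : ∀ s ∈ Icc 0 T, ‖S s‖ ≤ Ms)
    (hPc : ∀ Z, ContinuousOn (fun s => Pi s Z) (Icc 0 T)) (hPM : ∀ s ∈ Icc 0 T, ‖Pi s‖ ≤ M)
    (ht : t ∈ Icc 0 T) (Z : H) :
    IntervalIntegrable (fun τ => adjoint (S (τ - t))
      (riccatiTerm A C Q B δ (Pi τ) (S (τ - t) Z))) volume t T := by
  refine ContinuousOn.intervalIntegrable_of_Icc ht.2 ?_
  have hsub : Icc t T ⊆ Icc 0 T := Icc_subset_Icc_left ht.1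
  have hmem : ∀ τ ∈ Icc t T, τ - t ∈ Icc 0 T := fun τ hτ =>
    ⟨sub_nonneg.2 hτ.1, by linarith [hτ.2, ht.1]⟩
  have hS : ∀ Z, ContinuousOn (fun τ => S (τ - t) Z) (Icc t T) := fun Z =>
    (hSc Z).comp (by fun_prop) fun τ hτ => (hmem τ hτ).1
  have hP : ∀ {z : ℝ → H}, ContinuousOn z (Icc t T) →
      ContinuousOn (fun τ => Pi τ (z τ)) (Icc t T) := fun hz =>
    continuousOn_apply_of_norm_le (fun τ hτ => hPM τ (hsub hτ)) (fun Z => (hPc Z).mono hsub) hz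
  have hR : ContinuousOn (fun τ => riccatiTerm A C Q B δ (Pi τ) (S (τ - t) Z)) (Icc t T) := by
    have hz := hS Z
    have h1 := hP (A.continuous.comp_continuousOn hz)
    have h2 := (adjoint A).continuous.comp_continuousOn (hP hz)
    have h3 := (adjoint C).continuous.comp_continuousOn (hP (C.continuous.comp_continuousOn hz))
    have h4 := Q.continuous.comp_continuousOn hz
    have h5 := hP ((B ∘L adjoint B).continuous.comp_continuousOn (hP hz))
    exact (((h1.add h2).add h3).add h4).sub (h5.const_smul δ⁻¹)
  refine (continuousOn_apply_of_norm_le (fun τ hτ => hSM _ (hmem τ hτ)) hS hR).congr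
    fun τ hτ => ?_
  rw [← ContinuousLinearMap.star_eq_adjoint, (hSa _ (hmem τ hτ).1).star_eq]

/-- The error of a Galerkin approximation of a Riccati equation in the operator norm, as long as
the approximation is bounded. -/
theorem norm_sub_lift_le {L : K →L[ℝ] K} {A C Q G : H →L[ℝ] H} {B : ℝ →L[ℝ] H}
    {δ T M Ms : ℝ} {X : ℝ → K →L[ℝ] K} {P : H →L[ℝ] K} {S Pi : ℝ → H →L[ℝ] H}
    (hPP : P ∘L adjoint P = 1)
    (hSP : ∀ s, 0 ≤ s → P ∘L S s = NormedSpace.exp (s • L) ∘L P) (hL : IsSelfAdjoint L)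
    (h : IsRiccatiSolution L (P ∘L A ∘L adjoint P) (P ∘L C ∘L adjoint P) (P ∘L Q ∘L adjoint P)
      (P ∘L G ∘L adjoint P) (P ∘L B) δ T X)
    (hSa : ∀ s, 0 ≤ s → IsSelfAdjoint (S s))
    (hSc : ∀ Z, ContinuousOn (fun s => S s Z) (Ici 0))
    (hMs : 0 ≤ Ms) (hSM : ∀ s ∈ Icc 0 T, ‖S s‖ ≤ Ms)
    (hPi : IsMildRiccatiSolution S A C Q G B δ T Pi)
    (hM : 0 ≤ M) (hPM : ∀ s ∈ Icc 0 T, ‖Pi s‖ ≤ M)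
    {p : H →L[ℝ] H} (hp : p = adjoint P ∘L P) (hQ : p ∘L Q ∘L p = Q) (hG : p ∘L G ∘L p = G)
    {t : ℝ} (ht : t ∈ Icc 0 T) (hX : ∀ τ ∈ Icc t T, ‖adjoint P ∘L X τ ∘L P‖ ≤ M + 1) :
    ‖Pi t - adjoint P ∘L X t ∘L P‖ ≤
      2 * (T * (Ms ^ 2 * (2 * (M + 1) * (‖p ∘L A ∘L (1 - p)‖ + ‖C‖ * ‖C ∘L (1 - p)‖)))) *
        Real.exp (2 * (Ms ^ 2 * (2 * ‖A‖ + ‖C‖ ^ 2 + |δ⁻¹| * ‖B‖ ^ 2 * (M + (M + 1))) + 1) * T) := by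
  set κ := ‖p ∘L A ∘L (1 - p)‖ + ‖C‖ * ‖C ∘L (1 - p)‖ with hκ
  have hκ0 : 0 ≤ κ := by positivity
  -- The Lipschitz constant of the Riccati term for `‖Π‖ ≤ M` and `‖Y‖ ≤ M + 1`, times `Ms ^ 2` for
  -- the two semigroup factors. The added `1` makes it positive, as `le_of_integral_inequality`
  -- requires.
  set l := Ms ^ 2 * (2 * ‖A‖ + ‖C‖ ^ 2 + |δ⁻¹| * ‖B‖ ^ 2 * (M + (M + 1))) + 1 with hl
  have hl0 : 0 < l := by positivity
  set ε := Ms ^ 2 * (2 * (M + 1) * κ) with hε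
  have hε0 : 0 ≤ ε := by positivity
  have hT : 0 ≤ T := ht.1.trans ht.2
  set Y : ℝ → H →L[ℝ] H := fun t => adjoint P ∘L X t ∘L P with hY
  have hps : IsSelfAdjoint p := by
    rw [hp, ContinuousLinearMap.isSelfAdjoint_iff', ContinuousLinearMap.adjoint_comp,
      ContinuousLinearMap.adjoint_adjoint]
  have hp1 : ‖p‖ ≤ 1 := by
    have h1 : ‖adjoint P‖ * ‖adjoint P‖ ≤ 1 := by
      rw [← ContinuousLinearMap.norm_adjoint_comp_self, ContinuousLinearMap.adjoint_adjoint, hPP]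
      exact ContinuousLinearMap.norm_id_le
    rw [hp]
    refine (ContinuousLinearMap.opNorm_comp_le _ _).trans ?_
    rwa [← LinearIsometryEquiv.norm_map adjoint P]
  have hPP' : ∀ Z, P (adjoint P Z) = Z := fun Z => congrArg (fun M => M Z) hPP
  have hYp : ∀ τ, Y τ ∘L p = Y τ := fun τ => by
    ext Z; simp [hY, hp, hPP']
  have hpY : ∀ τ, p ∘L Y τ = Y τ := fun τ => by
    ext Z; simp [hY, hp, hPP']
  -- Gronwall is run on the set of times after which `Y` stays bounded by `M + 1`; this set is
  -- stable under moving towards `T`.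
  have main : ∀ s ∈ {s | s ∈ Icc 0 T ∧ ∀ τ ∈ Icc s T, ‖Y τ‖ ≤ M + 1},
      ‖Pi s - Y s‖ ≤ 2 * (T * ε) * Real.exp (2 * l * (T - s)) := by
    refine le_of_integral_inequality (e := fun s => ‖Pi s - Y s‖) (K := M + (M + 1)) ?_ hl0
      (by positivity) ?_ ?_
    · rintro s ⟨hs, hs'⟩
      refine ⟨hs.2, fun u hu => ⟨⟨hs.1.trans hu.1, hu.2⟩, fun τ hτ =>
        hs' τ ⟨hu.1.trans hτ.1, hτ.2⟩⟩⟩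
    · rintro s ⟨hs, hs'⟩
      exact (norm_sub_le _ _).trans (add_le_add (hPM s hs) (hs' s (left_mem_Icc.2 hs.2)))
    · rintro s ⟨hs, hs'⟩ β hβ hβ'
      have hβ0 : 0 ≤ ∫ τ in s..T, β τ := intervalIntegral.integral_nonneg hs.2 fun τ hτ =>
        (norm_nonneg _).trans (hβ' τ hτ)
      refine ContinuousLinearMap.opNorm_le_bound _ (by positivity) fun Z => ?_
      obtain ⟨i2, e2⟩ := h.lift_eq_integral hSP hL hs Z hp hY rfl
      have e1 := hPi.eq s hs Z
      have i1 := intervalIntegrable_mild_integrand (A := A) (C := C) (Q := Q) (B := B) (δ := δ)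
        hSa hSc hSM hPi.continuous hPM hs Z
      rw [sub_apply, e1, e2, hG, add_sub_add_left_eq_sub,
        ← intervalIntegral.integral_sub i1 i2]
      have hb : ∀ τ ∈ Ioc s T, ‖adjoint (S (τ - s)) (riccatiTerm A C Q B δ (Pi τ) (S (τ - s) Z)) -
          adjoint (S (τ - s)) ((Y τ ∘L A ∘L p + p ∘L adjoint A ∘L Y τ
            + p ∘L adjoint C ∘L Y τ ∘L C ∘L p + p ∘L Q ∘L p
            - δ⁻¹ • (Y τ ∘L B ∘L adjoint B ∘L Y τ)) (S (τ - s) Z))‖ ≤ (l * β τ + ε) * ‖Z‖ := by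
        intro τ hτ
        have hτ1 : τ ∈ Icc s T := Ioc_subset_Icc_self hτ
        have hτ0 : τ ∈ Icc 0 T := ⟨hs.1.trans hτ1.1, hτ.2⟩
        have hτs : τ - s ∈ Icc 0 T := ⟨sub_nonneg.2 hτ1.1, by linarith [hτ.2, hs.1]⟩
        have hd := norm_riccatiTerm_sub_le A C Q (Pi τ) (Y τ) p B δ hps hp1 hQ (hYp τ) (hpY τ)
        rw [← hκ] at hd
        have hYM := hs' τ hτ1
        have hPM' := hPM τ hτ0
        have hβτ := hβ' τ hτ1
        have hβτ0 : 0 ≤ β τ := (norm_nonneg _).trans hβτ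
        have hd' := hd.trans (b := _) (c := (2 * ‖A‖ + ‖C‖ ^ 2 + |δ⁻¹| * ‖B‖ ^ 2 * (M + (M + 1))) *
          β τ + 2 * (M + 1) * κ) (by gcongr)
        rw [← map_sub, ← sub_apply]
        refine (ContinuousLinearMap.le_of_opNorm_le _ (c := Ms) ?_ _).trans ?_
        · rw [LinearIsometryEquiv.norm_map]
          exact hSM _ hτs
        refine (mul_le_mul_of_nonneg_left (ContinuousLinearMap.le_of_opNorm_le_of_le _ hd'
          (ContinuousLinearMap.le_of_opNorm_le _ (hSM _ hτs) Z)) hMs).trans ?_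
        have hz : 0 ≤ β τ * ‖Z‖ := by positivity
        have : Ms * (((2 * ‖A‖ + ‖C‖ ^ 2 + |δ⁻¹| * ‖B‖ ^ 2 * (M + (M + 1))) *
          β τ + 2 * (M + 1) * κ) * (Ms * ‖Z‖)) = (l * β τ + ε) * ‖Z‖ - β τ * ‖Z‖ := by
          rw [hl, hε]; ring
        rw [this]
        linarith
      refine (intervalIntegral.norm_integral_le_of_norm_le hs.2 (ae_of_all _ hb)
        (Continuous.intervalIntegrable (by fun_prop) _ _)).trans ?_
      rw [intervalIntegral.integral_mul_const, intervalIntegral.integral_add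
        (Continuous.intervalIntegrable (by fun_prop) _ _)
        (Continuous.intervalIntegrable (by fun_prop) _ _), intervalIntegral.integral_const_mul,
        intervalIntegral.integral_const, smul_eq_mul, add_comm]
      have : (T - s) * ε ≤ T * ε := by
        have := hs.1
        gcongr
        linarith
      gcongr
  refine (main t ⟨ht, hX⟩).trans ?_
  have := ht.1
  gcongr
  linarith

end Galerkin

open ContinuousLinearMap (adjoint) in
/-- Galerkin approximations of a Riccati equation converge in the operator norm, uniformly in
time, when the coefficients are compatible with the projections up to an error that vanishes in
the operator norm. -/
theorem exists_tendsto_zero_norm_sub_lift_le {H : Type} [NormedAddCommGroup H]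
    [InnerProductSpace ℝ H] [CompleteSpace H] {K : ℕ → Type} [∀ N, NormedAddCommGroup (K N)]
    [∀ N, InnerProductSpace ℝ (K N)] [∀ N, CompleteSpace (K N)]
    {L : ∀ N, K N →L[ℝ] K N} {A C Q G : H →L[ℝ] H} {B : ℝ →L[ℝ] H} {δ T : ℝ}
    {X : ∀ N, ℝ → K N →L[ℝ] K N} {P : ∀ N, H →L[ℝ] K N} {S Pi : ℝ → H →L[ℝ] H} (hT : 0 ≤ T)
    (hPP : ∀ N, P N ∘L adjoint (P N) = 1)
    (hSP : ∀ N, ∀ s, 0 ≤ s → P N ∘L S s = NormedSpace.exp (s • L N) ∘L P N)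
    (hL : ∀ N, IsSelfAdjoint (L N))
    (h : ∀ N, IsRiccatiSolution (L N) (P N ∘L A ∘L adjoint (P N)) (P N ∘L C ∘L adjoint (P N))
      (P N ∘L Q ∘L adjoint (P N)) (P N ∘L G ∘L adjoint (P N)) (P N ∘L B) δ T (X N))
    (hSa : ∀ s, 0 ≤ s → IsSelfAdjoint (S s))
    (hSc : ∀ Z, ContinuousOn (fun s => S s Z) (Ici 0)) (hS0 : S 0 = 1)
    (hPi : IsMildRiccatiSolution S A C Q G B δ T Pi)
    {p : ℕ → H →L[ℝ] H} (hp : p = fun N => adjoint (P N) ∘L P N)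
    (hQ : ∀ N, p N ∘L Q ∘L p N = Q) (hG : ∀ N, p N ∘L G ∘L p N = G)
    (hA : Tendsto (fun N => ‖p N ∘L A ∘L (1 - p N)‖) atTop (𝓝 0))
    (hC : Tendsto (fun N => ‖C ∘L (1 - p N)‖) atTop (𝓝 0)) :
    ∃ η : ℕ → ℝ, Tendsto η atTop (𝓝 0) ∧
      ∀ᶠ N in atTop, ∀ t ∈ Icc 0 T, ‖Pi t - adjoint (P N) ∘L X N t ∘L P N‖ ≤ η N := by
  obtain ⟨M, hM, hPM⟩ := exists_norm_le_of_continuousOn_apply hPi.continuous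
  obtain ⟨Ms, hMs, hSM⟩ := exists_norm_le_of_continuousOn_apply (a := 0) (b := T)
    fun Z => (hSc Z).mono fun t ht => ht.1
  set η : ℕ → ℝ := fun N =>
      2 * (T * (Ms ^ 2 * (2 * (M + 1) * (‖p N ∘L A ∘L (1 - p N)‖ + ‖C‖ * ‖C ∘L (1 - p N)‖)))) *
        Real.exp (2 * (Ms ^ 2 * (2 * ‖A‖ + ‖C‖ ^ 2 + |δ⁻¹| * ‖B‖ ^ 2 * (M + (M + 1))) + 1) * T)
    with hη
  have hη0 : Tendsto η atTop (𝓝 0) := by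
    have := ((((((hA.add (hC.const_mul ‖C‖)).const_mul (2 * (M + 1))).const_mul
      (Ms ^ 2)).const_mul T).const_mul 2).mul_const (Real.exp (2 * (Ms ^ 2 * (2 * ‖A‖ + ‖C‖ ^ 2 +
        |δ⁻¹| * ‖B‖ ^ 2 * (M + (M + 1))) + 1) * T)))
    simp only [mul_zero, add_zero, zero_mul] at this
    exact this
  refine ⟨η, hη0, ?_⟩
  -- Taking `η N < 1` is what turns the conditional estimate into the strict bound `‖Y‖ < M + 1`
  -- needed for the continuity argument.
  filter_upwards [hη0.eventually_lt_const zero_lt_one] with N hN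
  have hest : ∀ t ∈ Icc 0 T, (∀ τ ∈ Icc t T, ‖adjoint (P N) ∘L X N τ ∘L P N‖ ≤ M + 1) →
      ‖Pi t - adjoint (P N) ∘L X N t ∘L P N‖ ≤ η N := fun t ht hX =>
    norm_sub_lift_le (hPP N) (hSP N) (hL N) (h N) hSa hSc hMs hSM hPi hM hPM
      (congrFun hp N) (hQ N) (hG N) ht hX
  have hXc : ContinuousOn (fun t => ‖adjoint (P N) ∘L X N t ∘L P N‖) (Icc 0 T) := by
    have h1 : ContinuousOn (X N) (Icc 0 T) := fun τ hτ => ((h N).deriv τ hτ).continuousWithinAt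
    fun_prop
  have hGT : G = Pi T := by
    have hTT : T ∈ Icc 0 T := right_mem_Icc.2 hT
    ext Z
    have := hPi.eq T hTT Z
    have h1 : adjoint (1 : H →L[ℝ] H) = 1 := by
      rw [← ContinuousLinearMap.star_eq_adjoint, star_one]
    simpa [hS0, h1] using this.symm
  have hXT : ‖adjoint (P N) ∘L X N T ∘L P N‖ ≤ M + 1 := by
    have e : adjoint (P N) ∘L X N T ∘L P N = p N ∘L G ∘L p N := by
      rw [(h N).terminal, hp]; rfl
    rw [e, hG N, hGT]
    exact (hPM T (right_mem_Icc.2 hT)).trans (by linarith)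
  have hall := le_of_continuousOn_of_forall_lt hXc hXT fun t ht hX => by
    have h1 := hest t ht hX
    have h2 := hPM t ht
    have h3 := norm_sub_norm_le (adjoint (P N) ∘L X N t ∘L P N) (Pi t)
    rw [norm_sub_rev] at h3
    linarith
  exact fun t ht => hest t ht fun τ hτ => hall τ ⟨ht.1.trans hτ.1, hτ.2⟩

/-! ### Semigroups acting on eigenvectors of their generator -/

/-- Uniqueness for a linear ODE. Right derivatives suffice, and they are all that the generator of a
semigroup provides. -/
theorem eq_exp_smul_of_hasDerivWithinAt_Ici {E : Type} [NormedAddCommGroup E] [NormedSpace ℝ E]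
    {h : ℝ → E} {a : ℝ} (hc : ContinuousOn h (Ici 0))
    (hd : ∀ s, 0 ≤ s → HasDerivWithinAt h (a • h s) (Ici s) s) {s : ℝ} (hs : 0 ≤ s) :
    h s = Real.exp (a * s) • h 0 := by
  have hg : ∀ t, HasDerivAt (fun t => Real.exp (a * t) • h 0) (a • Real.exp (a * t) • h 0) t :=
    fun t => by
      have h1 : HasDerivAt (fun t : ℝ => a * t) a t := by
        simpa using (hasDerivAt_id t).const_mul a
      refine (h1.exp.smul_const (h 0)).congr_deriv ?_
      rw [smul_smul, mul_comm]
  refine ODE_solution_unique_of_mem_Icc_right (v := fun _ x => a • x) (s := fun _ => univ)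
    (K := ‖a‖₊) (a := 0) (b := s) (fun t _ => (lipschitzWith_smul a).lipschitzOnWith)
    (hc.mono fun t ht => ht.1) (fun t ht => hd t ht.1) (fun _ _ => mem_univ _)
    (fun t _ => (hg t).continuousAt.continuousWithinAt) (fun t _ => (hg t).hasDerivWithinAt)
    (fun _ _ => mem_univ _) (by simp) (right_mem_Icc.2 hs)

/-- Since `S u v - S t v = S t (S (u - t) v - v)` for `u > t`, the orbit of `v` has right derivative
`S t (a • v) = a • S t v`. -/
theorem IsSemigroupGeneratedBy.apply_eigenvector {H : Type} [NormedAddCommGroup H]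
    [NormedSpace ℝ H] {S : ℝ → H →L[ℝ] H} {L : H →ₗ.[ℝ] H} (hS : IsSemigroupGeneratedBy S L)
    {a : ℝ} {v : H} (hv : (v, a • v) ∈ L.graph) {s : ℝ} (hs : 0 ≤ s) :
    S s v = Real.exp (a * s) • v := by
  have h0 : S 0 v = v := by rw [hS.map_zero]; rfl
  have := eq_exp_smul_of_hasDerivWithinAt_Ici (h := fun s => S s v) (a := a) (hS.continuous v) ?_ hs
  · simpa only [h0] using this
  intro t ht
  rw [← hasDerivWithinAt_Ioi_iff_Ici, hasDerivWithinAt_iff_tendsto_slope' self_notMem_Ioi]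
  have h1 := ((S t).continuous.tendsto _).comp ((hS.generator v (a • v)).2 hv)
  rw [map_smul] at h1
  have h2 : Tendsto (fun u => u - t) (𝓝[>] t) (𝓝[>] 0) := by
    refine tendsto_nhdsWithin_iff.2 ⟨?_, ?_⟩
    · have : Tendsto (fun u => u - t) (𝓝 t) (𝓝 (t - t)) :=
        (continuous_sub_right t).tendsto t
      rw [sub_self] at this
      exact this.mono_left nhdsWithin_le_nhds
    · filter_upwards [self_mem_nhdsWithin] with u hu
      exact mem_Ioi.2 (sub_pos.2 (mem_Ioi.1 hu))
  refine (h1.comp h2).congr' ?_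
  filter_upwards [self_mem_nhdsWithin] with u hu
  have h3 : S u v = S t (S (u - t) v) := by
    have := hS.map_add t (u - t) ht (sub_nonneg.2 (le_of_lt hu))
    rw [add_sub_cancel] at this
    rw [this]; rfl
  simp only [Function.comp, slope_def_module, h3, map_smul, map_sub]

/-! ### Orthogonality and totality of the cosines in `H¹(0,1)` -/

theorem H1.inner_def (u v : H1) : ⟪u, v⟫ = ⟪u.fn, v.fn⟫ + ⟪u.der, v.der⟫ := rfl

/-- Integration by parts moves the derivative from `u` to `φ_n'`. The boundary terms vanish by the
Neumann conditions on `φ_n`, and `-φ_n'' = λ_n φ_n`. -/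
theorem inner_eigfun (u : H1) (n : ℕ) : ⟪u, eigfun n⟫ =
    (1 + eigval n) * ∫ x, u.fn x * (normConst n * Real.cos (n * Real.pi * x)) ∂μI := by
  set φ : ℝ → ℝ := fun x => normConst n * Real.cos (n * Real.pi * x) with hφ
  set φ' : ℝ → ℝ := fun x => normConst n * (-Real.sin (n * Real.pi * x) * (n * Real.pi)) with hφ'
  have hφc : Continuous φ := by fun_prop
  have hφc' : Continuous φ' := by fun_prop
  have hd : ∀ x, HasDerivAt φ' (-eigval n * φ x) x := fun x => by
    have h : HasDerivAt (fun y : ℝ => Real.sin (n * Real.pi * y))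
        (Real.cos (n * Real.pi * x) * (n * Real.pi)) x :=
      (Real.hasDerivAt_sin _).comp x
        (((hasDerivAt_id x).const_mul ((n : ℝ) * Real.pi)).congr_deriv (mul_one _))
    refine ((h.neg.mul_const (n * Real.pi)).const_mul (normConst n)).congr_deriv ?_
    simp only [eigval, hφ]; ring
  have h0 : φ' 0 = 0 := by simp [hφ']
  have h1 : φ' 1 = 0 := by simp [hφ', Real.sin_nat_mul_pi]
  have e1 : ⟪u.fn, (eigfun n).fn⟫ = ∫ x, u.fn x * φ x ∂μI := by
    rw [integral_mul_eq_inner u.fn hφc, real_inner_comm]; rfl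
  have e2 : ⟪u.der, (eigfun n).der⟫ = ∫ x, u.der x * φ' x ∂μI := by
    rw [integral_mul_eq_inner u.der hφc', real_inner_comm]; rfl
  obtain ⟨c, hc⟩ := u.exists_ae_eq
  have hG : ContinuousOn (fun x => ∫ y in (0 : ℝ)..x, u.der y) (Icc 0 1) := by
    have := ((intervalIntegrable_L2 u.der).absolutelyContinuousOnInterval_intervalIntegral
      (c := 0) (by simp)).continuousOn
    rwa [uIcc_of_le zero_le_one] at this
  have e3 := integral_primitive_mul u.der hd (by fun_prop)
  rw [h1, mul_zero, zero_sub, interval_eq, interval_eq (fun x => u.der x * φ' x)] at e3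
  -- The additive constant in the representation of `u` drops out because `∫ φ'' = φ'(1) - φ'(0) =
  -- 0`.
  have e4 : ∫ x, c * (-eigval n * φ x) ∂μI = 0 := by
    rw [integral_const_mul, ← interval_eq, intervalIntegral.integral_eq_sub_of_hasDerivAt
      (fun x _ => hd x) (Continuous.intervalIntegrable (by fun_prop) _ _), h0, h1]
    simp
  have e5 : ∫ x, u.fn x * (-eigval n * φ x) ∂μI = -∫ x, u.der x * φ' x ∂μI := by
    have i1 : Integrable (fun x => c * (-eigval n * φ x)) μI :=
      (memLp_of_continuous (by fun_prop)).integrable (by norm_num)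
    have i2 : Integrable (fun x => (∫ y in (0 : ℝ)..x, u.der y) * (-eigval n * φ x)) μI :=
      ((hG.mul (Continuous.continuousOn (by fun_prop))).integrableOn_Icc).mono_set
        Ioo_subset_Icc_self
    have e := integral_add i1 i2
    rw [e4, zero_add] at e
    rw [← e3, ← e]
    refine integral_congr_ae ?_
    filter_upwards [hc] with x hx
    rw [hx, add_mul]
  have e6 : ∫ x, u.fn x * (-eigval n * φ x) ∂μI = -eigval n * ∫ x, u.fn x * φ x ∂μI := by
    rw [← integral_const_mul]
    refine integral_congr_ae (ae_of_all _ fun x => ?_)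
    ring
  rw [H1.inner_def, e1, e2]
  linarith

theorem eigval_nonneg (n : ℕ) : 0 ≤ eigval n := by unfold eigval; positivity

theorem eigval_injective : Function.Injective eigval := fun m n h => by
  have hpi : Real.pi ^ 2 ≠ 0 := by positivity
  have h2 := mul_left_cancel₀ hpi h
  exact_mod_cast (pow_left_inj₀ (Nat.cast_nonneg (α := ℝ) m) (Nat.cast_nonneg n) two_ne_zero).1 h2

theorem normConst_ne_zero (n : ℕ) : normConst n ≠ 0 := by
  unfold normConst
  split_ifs
  · exact one_ne_zero
  · positivity

/-- Computing the `H¹` product from either side yields the factors `1 + λ_n` and `1 + λ_m` on the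
same `L²` product, and the eigenvalues are distinct. -/
theorem inner_eigfun_eigfun {m n : ℕ} (h : m ≠ n) : ⟪eigfun m, eigfun n⟫ = 0 := by
  have key : ∀ m n, ⟪eigfun m, eigfun n⟫ = (1 + eigval n) * ⟪(eigfun m).fn, (eigfun n).fn⟫ := by
    intro m n
    have hφc : Continuous fun x : ℝ => normConst n * Real.cos (n * Real.pi * x) := by fun_prop
    rw [inner_eigfun, integral_mul_eq_inner (eigfun m).fn hφc, real_inner_comm]; rfl
  have h1 := key m n
  have h2 := key n m
  rw [real_inner_comm, real_inner_comm (eigfun m).fn] at h2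
  have h3 : (eigval n - eigval m) * ⟪(eigfun m).fn, (eigfun n).fn⟫ = 0 := by linarith
  rcases mul_eq_zero.1 h3 with h4 | h4
  · exact absurd (eigval_injective (sub_eq_zero.1 h4)).symm h
  · rw [h1, h4, mul_zero]

/-- The cosines `cos (nπ ·)` are total in `H¹(0,1)`. -/
theorem eq_zero_of_inner_eigfun {u : H1} (h : ∀ n, ⟪u, eigfun n⟫ = 0) : u = 0 := by
  have hint : ∀ {g : ℝ → ℝ}, Continuous g → Integrable (fun x => u.fn x * g x) μI := fun hg =>
    integrable_mul_continuous u.fn hg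
  have hcos : ∀ n : ℕ, ∫ x, u.fn x * Real.cos (n * Real.pi * x) ∂μI = 0 := fun n => by
    have h1 := h n
    rw [inner_eigfun] at h1
    have h2 := (mul_eq_zero.1 h1).resolve_left (by have := eigval_nonneg n; positivity)
    have h3 : ∫ x, u.fn x * (normConst n * Real.cos (n * Real.pi * x)) ∂μI =
        normConst n * ∫ x, u.fn x * Real.cos (n * Real.pi * x) ∂μI := by
      rw [← integral_const_mul]
      refine integral_congr_ae (ae_of_all _ fun x => ?_)
      ring
    rw [h3] at h2
    exact (mul_eq_zero.1 h2).resolve_left (normConst_ne_zero n)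
  -- Powers of `cos (π x)` reduce to cosines by induction, using the product formula for `cos (π x)
  -- cos ((n + 1) π x)`.
  have hpow : ∀ k n : ℕ,
      ∫ x, u.fn x * (Real.cos (Real.pi * x) ^ k * Real.cos (n * Real.pi * x)) ∂μI = 0 := by
    intro k
    induction k with
    | zero => simpa using hcos
    | succ k ih =>
      rintro (_ | n)
      · rw [← ih 1]
        refine integral_congr_ae (ae_of_all _ fun x => ?_)
        simp [pow_succ]
      · have e : ∀ x : ℝ, u.fn x * (Real.cos (Real.pi * x) ^ (k + 1) *
            Real.cos ((n + 1 : ℕ) * Real.pi * x)) =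
            2⁻¹ * (u.fn x * (Real.cos (Real.pi * x) ^ k * Real.cos ((n + 2 : ℕ) * Real.pi * x)) +
              u.fn x * (Real.cos (Real.pi * x) ^ k * Real.cos (n * Real.pi * x))) := fun x => by
          have e1 : ((n + 2 : ℕ) : ℝ) * Real.pi * x =
            (n + 1 : ℕ) * Real.pi * x + Real.pi * x := by push_cast; ring
          have e2 : (n : ℝ) * Real.pi * x =
            (n + 1 : ℕ) * Real.pi * x - Real.pi * x := by push_cast; ring
          rw [e1, e2, Real.cos_add, Real.cos_sub]
          ring
        simp only [e]
        rw [integral_const_mul, integral_add (hint (by fun_prop)) (hint (by fun_prop)), ih, ih]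
        simp
  have hpoly : ∀ q : Polynomial ℝ, ∫ x, u.fn x * q.eval (Real.cos (Real.pi * x)) ∂μI = 0 := by
    intro q
    induction q using Polynomial.induction_on' with
    | add p q hp hq =>
      simp only [Polynomial.eval_add, mul_add]
      rw [integral_add (hint (by fun_prop)) (hint (by fun_prop)), hp, hq, add_zero]
    | monomial k a =>
      have := hpow k 0
      simp only [Nat.cast_zero, zero_mul, Real.cos_zero, mul_one] at this
      simp only [Polynomial.eval_monomial]
      have e : ∀ x : ℝ, u.fn x * (a * Real.cos (Real.pi * x) ^ k) =
        a * (u.fn x * Real.cos (Real.pi * x) ^ k) := fun x => by ring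
      simp only [e]
      rw [integral_const_mul, this, mul_zero]
  have hrint : Integrable (fun x => u.rep x * u.rep x) μI :=
    ((u.continuousOn_rep.mul u.continuousOn_rep).integrableOn_Icc).mono_set Ioo_subset_Icc_self
  have hai : Integrable (fun x => |u.rep x|) μI :=
    (u.continuousOn_rep.abs.integrableOn_Icc).mono_set Ioo_subset_Icc_self
  set m := ∫ x, |u.rep x| ∂μI with hm
  have hm0 : 0 ≤ m := integral_nonneg fun x => abs_nonneg _
  -- In the variable `y = cos (π x)` the function `u` is continuous on `[-1,1]`, so Weierstrass
  -- approximates it by polynomials `q`. As `u` is orthogonal in `L²` to `q (cos (π x))`, this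
  -- forces `∫ u² = 0`.
  have hfc : ContinuousOn (fun y => u.rep (Real.arccos y / Real.pi)) (Icc (-1) 1) := by
    refine u.continuousOn_rep.comp (by fun_prop) fun y _ => ?_
    exact ⟨div_nonneg (Real.arccos_nonneg y) Real.pi_pos.le,
      (div_le_one Real.pi_pos).2 (Real.arccos_le_pi y)⟩
  have hsq : ∫ x, u.rep x * u.rep x ∂μI = 0 := by
    refine le_antisymm (le_of_forall_pos_le_add fun ε hε => ?_)
      (integral_nonneg fun x => mul_self_nonneg _)
    obtain ⟨q, hq⟩ := exists_polynomial_near_of_continuousOn (-1) 1 _ hfc (ε / (m + 1))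
      (by positivity)
    have e0 : ∫ x, u.rep x * q.eval (Real.cos (Real.pi * x)) ∂μI = 0 := by
      rw [← hpoly q]
      refine integral_congr_ae ?_
      filter_upwards [u.rep_ae_eq] with x hx
      rw [hx]
    have i0 : Integrable (fun x => u.rep x * q.eval (Real.cos (Real.pi * x))) μI := by
      refine (hint (g := fun x => q.eval (Real.cos (Real.pi * x))) (by fun_prop)).congr ?_
      filter_upwards [u.rep_ae_eq] with x hx
      rw [hx]
    have e1 : ∫ x, u.rep x * u.rep x ∂μI =
        ∫ x, (u.rep x * u.rep x - u.rep x * q.eval (Real.cos (Real.pi * x))) ∂μI := by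
      rw [integral_sub hrint i0, e0, sub_zero]
    rw [e1, zero_add]
    have e2 : ∫ x, (u.rep x * u.rep x - u.rep x * q.eval (Real.cos (Real.pi * x))) ∂μI ≤
        ∫ x, ε / (m + 1) * |u.rep x| ∂μI := by
      refine integral_mono_ae (hrint.sub i0) (hai.const_mul _) ?_
      filter_upwards [ae_restrict_mem measurableSet_Ioo] with x hx
      have h1 := hq (Real.cos (Real.pi * x)) ⟨Real.neg_one_le_cos _, Real.cos_le_one _⟩
      have hpx : 0 ≤ Real.pi * x := mul_nonneg Real.pi_pos.le hx.1.le
      have hpx' : Real.pi * x ≤ Real.pi := mul_le_of_le_one_right Real.pi_pos.le hx.2.le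
      rw [Real.arccos_cos hpx hpx', mul_div_cancel_left₀ _ Real.pi_ne_zero] at h1
      rw [← mul_sub]
      refine (le_abs_self _).trans ?_
      rw [abs_mul, mul_comm, abs_sub_comm]
      gcongr
    refine e2.trans ?_
    rw [integral_const_mul, ← hm, div_mul_eq_mul_div, div_le_iff₀ (by positivity)]
    nlinarith
  have hz := (integral_eq_zero_iff_of_nonneg (fun x => mul_self_nonneg _) hrint).1 hsq
  refine H1.ext_fn (Lp.ext ?_)
  have h0 : ((0 : H1).fn : ℝ → ℝ) =ᵐ[μI] 0 := Lp.coeFn_zero ℝ 2 μI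
  filter_upwards [hz, u.rep_ae_eq, h0] with x h1 h2 h3
  rw [h2, h3]
  exact mul_self_eq_zero.1 h1

/-! ### Diagonalization of the semigroup and of its Galerkin compressions -/

open ContinuousLinearMap (adjoint)

variable {d : ℕ}

/-- The inclusion of `ℝ^d` into the state space. -/
noncomputable def inX (d : ℕ) : EuclideanSpace ℝ (Fin d) →L[ℝ] State d :=
  col (ContinuousLinearMap.id ℝ _) 0 0

/-- The inclusion of `H¹(0,1)` into the state space. -/
noncomputable def inZ (d : ℕ) : H1 →L[ℝ] State d := col 0 0 (ContinuousLinearMap.id ℝ H1)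

section Components

variable {W : Type} [NormedAddCommGroup W] [NormedSpace ℝ W] (f : W →L[ℝ] EuclideanSpace ℝ (Fin d))
  (g : W →L[ℝ] ℝ) (h : W →L[ℝ] H1) (w : W)

theorem prX_col : prX (col f g h w) = f w := rfl

theorem prY_col : prY (col f g h w) = g w := rfl

theorem state_ext {U V : State d} (hX : prX U = prX V) (hY : prY U = prY V) (hZ : prZ U = prZ V) :
    U = V :=
  WithLp.ofLp_injective 2 (Prod.ext hX (WithLp.ofLp_injective 2 (Prod.ext hY hZ)))

theorem state_inner (U V : State d) :
    ⟪U, V⟫ = ⟪prX U, prX V⟫ + (⟪prY U, prY V⟫ + ⟪prZ U, prZ V⟫) := rfl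

end Components

theorem mem_graph_deltaT {Z V : State d} : (Z, V) ∈ (deltaT d).graph ↔
    ∃ w : H1, HasLaplacian (prZ Z) w.fn 0 0 ∧ V = inZ d w := by
  rw [LinearPMap.mem_graph_iff]
  constructor
  · rintro ⟨y, hy, hV⟩
    subst hy
    exact ⟨_, neumannLaplacian_spec ⟨prZ (y : State d), y.2⟩, hV.symm⟩
  · rintro ⟨w, hw, rfl⟩
    refine ⟨⟨Z, w, hw⟩, rfl, ?_⟩
    exact congrArg (inZ d) (neumannLaplacian_eq (u := ⟨prZ Z, w, hw⟩) hw)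

/-- The eigenvectors of `Δ̃` that are adapted to the decomposition of the state space, with their
eigenvalues. -/
inductive IsMode : ℝ → State d → Prop
  | base (Z : State d) (hZ : prZ Z = 0) : IsMode 0 Z
  | eig (n : ℕ) : IsMode (-eigval n) (inZ d (eigfun n))

theorem IsMode.mem_graph {a : ℝ} {v : State d} (h : IsMode a v) :
    (v, a • v) ∈ (deltaT d).graph := by
  rw [mem_graph_deltaT]
  cases h with
  | base Z hZ =>
    refine ⟨0, ?_, by simp⟩
    rw [hZ]
    exact HasLaplacian.zero
  | eig n => exact ⟨_, eigfun_hasLaplacian n, (map_smul _ _ _).symm⟩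

theorem inner_inZ (u : H1) (V : State d) : ⟪inZ d u, V⟫ = ⟪u, prZ V⟫ := by
  rw [state_inner]
  change ⟪(0 : EuclideanSpace ℝ (Fin d)), prX V⟫ + (⟪(0 : ℝ), prY V⟫ + ⟪u, prZ V⟫) = _
  rw [inner_zero_left, inner_zero_left, zero_add, zero_add]

theorem IsMode.eq_or_inner_eq_zero {a b : ℝ} {v w : State d} (hv : IsMode a v) (hw : IsMode b w) :
    a = b ∨ ⟪v, w⟫ = 0 := by
  cases hv with
  | base Z hZ =>
    cases hw with
    | base Z' hZ' => exact Or.inl rfl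
    | eig n =>
      right
      rw [real_inner_comm, inner_inZ, hZ, inner_zero_right]
  | eig m =>
    cases hw with
    | base Z' hZ' =>
      right
      rw [inner_inZ, hZ', inner_zero_right]
    | eig n =>
      by_cases hmn : m = n
      · exact Or.inl (by rw [hmn])
      · right
        rw [inner_inZ]
        exact inner_eigfun_eigfun hmn

/-- The projection onto `𝓗_N` either fixes or annihilates each mode; this is why it respects the
spectral decomposition of `Δ̃`. -/
theorem IsMode.mem_or_mem_orthogonal {a : ℝ} {v : State d} (h : IsMode a v) (N : ℕ) :
    v ∈ HN d N ∨ v ∈ (HN d N)ᗮ := by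
  cases h with
  | base _ hZ =>
    left
    change prZ v ∈ H1N N
    rw [hZ]
    exact zero_mem _
  | eig n =>
    by_cases hn : n ≤ N
    · exact Or.inl (Submodule.subset_span ⟨n, hn, rfl⟩)
    · right
      rw [Submodule.mem_orthogonal']
      intro V hV
      rw [inner_inZ]
      have hsub : H1N N ≤ (Submodule.span ℝ {eigfun n})ᗮ := by
        rw [H1N, Submodule.span_le]
        rintro _ ⟨m, hm, rfl⟩
        rw [SetLike.mem_coe, Submodule.mem_orthogonal_singleton_iff_inner_right]
        exact inner_eigfun_eigfun fun h => hn (h ▸ hm)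
      exact Submodule.mem_orthogonal_singleton_iff_inner_right.1 (hsub hV)

/-- The set of all adapted eigenvectors of `Δ̃`. -/
def modes (d : ℕ) : Set (State d) := {v | ∃ a, IsMode a v}

/-- Orthogonality to the cosine modes kills the `H¹` component of `Z`; then `Z` is itself a `base`
mode, hence orthogonal to itself. -/
theorem orthogonal_modes : (Submodule.span ℝ (modes d))ᗮ = ⊥ := by
  rw [Submodule.eq_bot_iff]
  intro Z hZ
  rw [Submodule.mem_orthogonal] at hZ
  have hm : ∀ v ∈ modes d, ⟪v, Z⟫ = 0 := fun v hv => hZ v (Submodule.subset_span hv)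
  have hz : prZ Z = 0 := eq_zero_of_inner_eigfun fun n => by
    rw [real_inner_comm, ← inner_inZ]
    exact hm _ ⟨_, IsMode.eig n⟩
  exact inner_self_eq_zero.1 (hm Z ⟨0, IsMode.base Z hz⟩)

theorem dense_span_modes : Dense (Submodule.span ℝ (modes d) : Set (State d)) :=
  Submodule.dense_iff_topologicalClosure_eq_top.2
    (Submodule.topologicalClosure_eq_top_iff.2 orthogonal_modes)

theorem isSelfAdjoint_of_modes {M : State d →L[ℝ] State d}
    (h : ∀ v ∈ modes d, ∀ w ∈ modes d, ⟪M v, w⟫ = ⟪v, M w⟫) : IsSelfAdjoint M := by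
  rw [ContinuousLinearMap.isSelfAdjoint_iff']
  refine ContinuousLinearMap.ext_on dense_span_modes fun v hv => ?_
  refine ext_inner_right ℝ fun Z => ?_
  -- Density is used twice: here to free the second argument, and above to free the first.
  have : innerSL ℝ v ∘L M = innerSL ℝ (M v) :=
    ContinuousLinearMap.ext_on dense_span_modes fun w hw => (h v hv w hw).symm
  rw [ContinuousLinearMap.adjoint_inner_left]
  exact congrArg (fun L => L Z) this

theorem isSelfAdjoint_semigroup {S : ℝ → State d →L[ℝ] State d}
    (hS : IsSemigroupGeneratedBy S (deltaT d)) {s : ℝ} (hs : 0 ≤ s) : IsSelfAdjoint (S s) := by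
  refine isSelfAdjoint_of_modes ?_
  rintro v ⟨a, hv⟩ w ⟨b, hw⟩
  rw [hS.apply_eigenvector hv.mem_graph hs, hS.apply_eigenvector hw.mem_graph hs,
    real_inner_smul_left, real_inner_smul_right]
  rcases hv.eq_or_inner_eq_zero hw with rfl | h0
  · rfl
  · rw [h0, mul_zero, mul_zero]

theorem adjoint_projN_comp (N : ℕ) :
    adjoint (projN d N) ∘L projN d N = (HN d N).starProjection := by
  rw [projN, Submodule.adjoint_orthogonalProjectionOnto]
  rfl

theorem projN_comp_adjoint (N : ℕ) : projN d N ∘L adjoint (projN d N) = 1 := by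
  ext1 Z
  change projN d N (projNadj d N Z) = Z
  rw [projNadj_apply]
  exact Submodule.orthogonalProjectionOnto_mem_subspace_eq_self Z

theorem deltaN_projN {a : ℝ} {v : State d} (h : IsMode a v) (N : ℕ) :
    deltaN d N (projN d N v) = a • projN d N v := by
  rcases h.mem_or_mem_orthogonal N with hv | hv
  · have e : projNadj d N (projN d N v) = v := by
      rw [projNadj_apply]
      exact (Submodule.starProjection_eq_self_iff).2 hv
    have hg := (LinearPMap.mem_graph_iff _).1 h.mem_graph
    obtain ⟨y, hy, hy'⟩ := hg
    have e2 : (⟨projNadj d N (projN d N v), projNadj_mem d N _⟩ : (deltaT d).domain) = y :=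
      Subtype.ext (e.trans hy.symm)
    change projN d N (deltaT d ⟨projNadj d N (projN d N v), projNadj_mem d N _⟩) = _
    rw [e2, hy', map_smul]
  · have e : projN d N v = 0 := Submodule.orthogonalProjectionOnto_eq_zero_iff.2 hv
    rw [e, map_zero, smul_zero]

theorem isSelfAdjoint_deltaN (N : ℕ) : IsSelfAdjoint (deltaN d N) := by
  -- Symmetry is tested on the modes for the lift to the whole space, then recovered on `𝓗_N` by
  -- conjugating back with `P_N`.
  have hM : IsSelfAdjoint (adjoint (projN d N) ∘L deltaN d N ∘L projN d N) := by
    refine isSelfAdjoint_of_modes ?_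
    rintro v ⟨a, hv⟩ w ⟨b, hw⟩
    change ⟪adjoint (projN d N) (deltaN d N (projN d N v)), w⟫ =
      ⟪v, adjoint (projN d N) (deltaN d N (projN d N w))⟫
    rw [deltaN_projN hv, deltaN_projN hw, ContinuousLinearMap.adjoint_inner_left,
      ContinuousLinearMap.adjoint_inner_right, real_inner_smul_left, real_inner_smul_right]
    rcases hv.eq_or_inner_eq_zero hw with rfl | h0
    · rfl
    · have : ⟪projN d N v, projN d N w⟫ = 0 := by
        rcases hv.mem_or_mem_orthogonal N with hv' | hv'
        · have e : adjoint (projN d N) (projN d N v) = v := by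
            change projNadj d N (projN d N v) = v
            rw [projNadj_apply]
            exact (Submodule.starProjection_eq_self_iff).2 hv'
          rw [← ContinuousLinearMap.adjoint_inner_left, e, h0]
        · have e : projN d N v = 0 := Submodule.orthogonalProjectionOnto_eq_zero_iff.2 hv'
          rw [e, inner_zero_left]
      rw [this, mul_zero, mul_zero]
  have h1 := hM.conj_adjoint (projN d N)
  have e : projN d N ∘L (adjoint (projN d N) ∘L deltaN d N ∘L projN d N) ∘L
      adjoint (projN d N) = deltaN d N := by
    have h2 : ∀ V, projN d N (adjoint (projN d N) V) = V := fun V =>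
      congrArg (fun M => M V) (projN_comp_adjoint N)
    ext1 V
    change projN d N (adjoint (projN d N) (deltaN d N (projN d N (adjoint (projN d N) V)))) = _
    rw [h2, h2]
  rwa [e] at h1

/-- Two semigroups that are diagonalized by the same total family are intertwined. -/
theorem comp_eq_exp_comp {H K : Type} [NormedAddCommGroup H] [NormedSpace ℝ H]
    [NormedAddCommGroup K] [InnerProductSpace ℝ K] [CompleteSpace K] {P : H →L[ℝ] K}
    {L : K →L[ℝ] K} {U : H →L[ℝ] H} {s : ℝ} (hs : 0 ≤ s) {E : Set H}
    (hE : Dense (Submodule.span ℝ E : Set H))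
    (h : ∀ v ∈ E, ∃ a : ℝ, U v = Real.exp (a * s) • v ∧ L (P v) = a • P v) :
    P ∘L U = NormedSpace.exp (s • L) ∘L P := by
  refine ContinuousLinearMap.ext_on hE fun v hv => ?_
  obtain ⟨a, h1, h2⟩ := h v hv
  change P (U v) = NormedSpace.exp (s • L) (P v)
  rw [h1, map_smul]
  have hd : ∀ t, HasDerivAt (fun t : ℝ => NormedSpace.exp (t • L) (P v))
      (a • NormedSpace.exp (t • L) (P v)) t := fun t => by
    have h3 := (ContinuousLinearMap.apply ℝ K (P v)).hasFDerivAt.comp_hasDerivAt t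
      (hasDerivAt_exp_smul_const (𝕂 := ℝ) L t)
    refine h3.congr_deriv ?_
    change NormedSpace.exp (t • L) (L (P v)) = _
    rw [h2, map_smul]
  have h4 := eq_exp_smul_of_hasDerivWithinAt_Ici
    (h := fun t : ℝ => NormedSpace.exp (t • L) (P v)) (a := a)
    (fun t _ => (hd t).continuousAt.continuousWithinAt) (fun t _ => (hd t).hasDerivWithinAt) hs
  rw [h4]
  simp

/-! ### Convergence of the projections and consistency of the coefficients -/

theorem monotone_HN : Monotone (HN d) := fun _ _ h =>
  Submodule.comap_mono (Submodule.span_mono (image_mono (Iic_subset_Iic.2 h)))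

theorem tendsto_starProjection_HN (Z : State d) :
    Tendsto (fun N => (HN d N).starProjection Z) atTop (𝓝 Z) := by
  refine Submodule.starProjection_tendsto_self _ monotone_HN Z ?_
  rw [← Submodule.topologicalClosure_eq_top_iff.2 (orthogonal_modes (d := d))]
  refine Submodule.topologicalClosure_mono (Submodule.span_le.2 ?_)
  rintro v ⟨a, hv⟩
  cases hv with
  | base _ hZ =>
    refine Submodule.mem_iSup_of_mem 0 ?_
    change prZ v ∈ H1N 0
    rw [hZ]
    exact zero_mem _
  | eig n => exact Submodule.mem_iSup_of_mem n (Submodule.subset_span ⟨n, mem_Iic.2 le_rfl, rfl⟩)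

/-- Bounded linear forms composed with `1 - P_N` tend to zero in the operator norm. -/
theorem tendsto_norm_comp_one_sub (γ : State d →L[ℝ] ℝ) :
    Tendsto (fun N => ‖γ ∘L (1 - (HN d N).starProjection)‖) atTop (𝓝 0) := by
  obtain ⟨g, rfl⟩ := (InnerProductSpace.toDual ℝ (State d)).surjective γ
  -- As the projection is self-adjoint, composing the form with `1 - p` amounts to applying `1 - p`
  -- to its Riesz vector, so pointwise convergence is enough.
  have e : ∀ N, (InnerProductSpace.toDual ℝ (State d) g) ∘L (1 - (HN d N).starProjection) =
      InnerProductSpace.toDual ℝ (State d) (g - (HN d N).starProjection g) := fun N => by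
    ext Z
    change ⟪g, Z - (HN d N).starProjection Z⟫ = ⟪g - (HN d N).starProjection g, Z⟫
    rw [inner_sub_left, inner_sub_right, Submodule.inner_starProjection_left_eq_right]
  simp only [e, LinearIsometryEquiv.norm_map]
  have := (tendsto_starProjection_HN g).const_sub g |>.norm
  simpa using this

theorem prX_eq_zero_of_mem_orthogonal {N : ℕ} {V : State d} (hV : V ∈ (HN d N)ᗮ) :
    prX V = 0 ∧ prY V = 0 := by
  have key : ∀ U : State d, prZ U = 0 → ⟪prX U, prX V⟫ + ⟪prY U, prY V⟫ = 0 := fun U hU => by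
    have hmem : U ∈ HN d N := by
      change prZ U ∈ H1N N
      rw [hU]
      exact zero_mem _
    have := (Submodule.mem_orthogonal _ _).1 hV U hmem
    rwa [state_inner, hU, inner_zero_left, add_zero] at this
  -- The test vector keeps the two finite-dimensional components of `V` and drops the third, so it
  -- lies in `𝓗_N`.
  have h1 := key (col prX prY 0 V) rfl
  rw [prX_col, prY_col] at h1
  have h2 : 0 ≤ ⟪prX V, prX V⟫ := real_inner_self_nonneg
  have h3 : 0 ≤ ⟪prY V, prY V⟫ := real_inner_self_nonneg
  have h4 : ⟪prX V, prX V⟫ = 0 := by linarith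
  have h5 : ⟪prY V, prY V⟫ = 0 := by linarith
  exact ⟨inner_self_eq_zero.1 h4, inner_self_eq_zero.1 h5⟩

theorem one_sub_starProjection_mem (N : ℕ) (Z : State d) :
    (1 - (HN d N).starProjection : State d →L[ℝ] State d) Z ∈ (HN d N)ᗮ :=
  Submodule.sub_starProjection_mem_orthogonal Z

/-- On `V` orthogonal to `𝓗_N`, `Ã` reduces to `z(0) (B, 0, 0) + c V`, and the projection kills `c
V`. Without the outer projection this last term would not vanish in norm. -/
theorem starProjection_comp_aT_comp (A : Matrix (Fin d) (Fin d) ℝ) (B : EuclideanSpace ℝ (Fin d))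
    (c μ : ℝ) (ρ : H1) (N : ℕ) :
    (HN d N).starProjection ∘L aT A B c μ ρ ∘L (1 - (HN d N).starProjection) =
      ((evalZero ∘L prZ) ∘L (1 - (HN d N).starProjection)).smulRight
        ((HN d N).starProjection (inX d B)) := by
  ext1 Z
  set V := (1 - (HN d N).starProjection : State d →L[ℝ] State d) Z with hV
  have hVo : V ∈ (HN d N)ᗮ := one_sub_starProjection_mem N Z
  obtain ⟨hX, hY⟩ := prX_eq_zero_of_mem_orthogonal hVo
  have e : aT A B c μ ρ V = evalZero (prZ V) • inX d B + c • V := by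
    refine state_ext ?_ ?_ ?_
    · rw [map_add, map_smul, map_smul, hX]
      change Matrix.toEuclideanCLM (𝕜 := ℝ) A (prX V) - ρ.rep 0 • (prY V • B)
        + evalZero (prZ V) • B = evalZero (prZ V) • B + c • 0
      rw [hX, hY]
      simp
    · rw [map_add, map_smul, map_smul, hY]
      change μ • prY V = evalZero (prZ V) • 0 + c • 0
      rw [hY]
      simp
    · rw [map_add, map_smul, map_smul]
      change c • prZ V = evalZero (prZ V) • 0 + c • prZ V
      simp
  change (HN d N).starProjection (aT A B c μ ρ V) = evalZero (prZ V) • _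
  rw [e, map_add, map_smul, map_smul, (Submodule.starProjection_apply_eq_zero_iff _).2 hVo]
  simp

theorem cT_comp (C : Matrix (Fin d) (Fin d) ℝ) (D : EuclideanSpace ℝ (Fin d)) (ρ : H1) (N : ℕ) :
    cT C D ρ ∘L (1 - (HN d N).starProjection) =
      ((evalZero ∘L prZ) ∘L (1 - (HN d N).starProjection)).smulRight (inX d D) := by
  ext1 Z
  set V := (1 - (HN d N).starProjection : State d →L[ℝ] State d) Z with hV
  obtain ⟨hX, hY⟩ := prX_eq_zero_of_mem_orthogonal (one_sub_starProjection_mem N Z)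
  rw [← hV] at hX hY
  change cT C D ρ V = evalZero (prZ V) • inX d D
  refine state_ext ?_ ?_ ?_
  · rw [map_smul]
    change Matrix.toEuclideanCLM (𝕜 := ℝ) C (prX V) - ρ.rep 0 • (prY V • D)
        + evalZero (prZ V) • D = evalZero (prZ V) • D
    rw [hX, hY]
    simp
  · rw [map_smul]
    exact (smul_zero _).symm
  · rw [map_smul]
    exact (smul_zero _).symm

/-- Applies to `Q̃` and `G̃`, which only see and only produce the components in `ℝ^d × ℝ`, where the
projection is the identity. -/
theorem starProjection_comp_comp_eq (N : ℕ) {M : State d →L[ℝ] State d}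
    (h0 : ∀ V, prX V = 0 → prY V = 0 → M V = 0) (h1 : ∀ V, prZ (M V) = 0) :
    (HN d N).starProjection ∘L M ∘L (HN d N).starProjection = M := by
  ext1 Z
  have e : M ((HN d N).starProjection Z) = M Z := by
    obtain ⟨hX, hY⟩ := prX_eq_zero_of_mem_orthogonal (one_sub_starProjection_mem N Z)
    have := h0 _ hX hY
    change M (Z - (HN d N).starProjection Z) = 0 at this
    rw [map_sub] at this
    exact (sub_eq_zero.1 this).symm
  change (HN d N).starProjection (M ((HN d N).starProjection Z)) = M Z
  rw [e, Submodule.starProjection_eq_self_iff]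
  change prZ (M Z) ∈ H1N N
  rw [h1]
  exact zero_mem _

end SpectralRiccati

open SpectralRiccati in
theorem proposition5 {d : ℕ} (A C Q G : Matrix (Fin d) (Fin d) ℝ) (B D : EuclideanSpace ℝ (Fin d))
    (c μ r δ T : ℝ) (hμ : c < μ) (hQ : Q.PosSemidef) (hG : G.PosSemidef)
    (hr : 0 < r) (hδ : 0 < δ) (hT : 0 < T)
    (ρ : H1) (hρ : IsLifting c μ ρ)
    (S : ℝ → State d →L[ℝ] State d) (hS : IsSemigroupGeneratedBy S (deltaT d))
    (Pi : ℝ → State d →L[ℝ] State d)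
    (hPi : IsMildRiccatiSolution S (aT A B c μ ρ) (cT C D ρ) (qT Q r) (gT G) (bT d ρ) δ T Pi)
    (PiN : ∀ N : ℕ, ℝ → HN d N →L[ℝ] HN d N)
    (hPiN : ∀ N : ℕ, IsRiccatiSolution (deltaN d N) (compress N (aT A B c μ ρ))
      (compress N (cT C D ρ)) (compress N (qT Q r)) (compress N (gT G))
      (projN d N ∘L bT d ρ) δ T (PiN N))
    (Z : State d) :
    (∀ t ∈ Set.Icc 0 T, Filter.Tendsto
      (fun N : ℕ => ‖Pi t Z - projNadj d N (PiN N t (projN d N Z))‖) Filter.atTop (nhds 0)) ∧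
    Filter.Tendsto
      (fun N : ℕ => ⨆ t ∈ Set.Icc 0 T, ‖Pi t Z - projNadj d N (PiN N t (projN d N Z))‖ₑ)
      Filter.atTop (nhds 0) := by
  have hγ := tendsto_norm_comp_one_sub (evalZero ∘L prZ (d := d))
  obtain ⟨η, hη, hle⟩ := exists_tendsto_zero_norm_sub_lift_le (P := projN d)
    (p := fun N => (HN d N).starProjection) hT.le projN_comp_adjoint
    (fun N s hs => comp_eq_exp_comp hs dense_span_modes fun v ⟨a, hv⟩ =>
      ⟨a, hS.apply_eigenvector hv.mem_graph hs, deltaN_projN hv N⟩) isSelfAdjoint_deltaN hPiN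
    (fun s hs => isSelfAdjoint_semigroup hS hs) hS.continuous hS.map_zero hPi
    (funext fun N => (adjoint_projN_comp N).symm)
    (fun N => starProjection_comp_comp_eq N (fun V hX hY => state_ext
      (by change Matrix.toEuclideanCLM (𝕜 := ℝ) Q (prX V) = 0; rw [hX, map_zero])
      (by change r • prY V = 0; rw [hY, smul_zero]) rfl) fun _ => rfl)
    (fun N => starProjection_comp_comp_eq N (fun V hX _ => state_ext
      (by change Matrix.toEuclideanCLM (𝕜 := ℝ) G (prX V) = 0; rw [hX, map_zero])
      rfl rfl) fun _ => rfl)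
    (by
      have hB : Filter.Tendsto (fun N => ‖(evalZero ∘L prZ (d := d)) ∘L
          (1 - (HN d N).starProjection)‖ * ‖inX d B‖) Filter.atTop (nhds 0) := by
        simpa only [zero_mul] using hγ.mul_const ‖inX d B‖
      refine squeeze_zero (fun _ => norm_nonneg _) (fun N => ?_) hB
      rw [starProjection_comp_aT_comp, ContinuousLinearMap.norm_smulRight_apply]
      exact mul_le_mul_of_nonneg_left (Submodule.norm_starProjection_apply_le _ _)
        (norm_nonneg _))
    (by
      simp only [cT_comp, ContinuousLinearMap.norm_smulRight_apply]
      simpa using hγ.mul_const ‖inX d D‖)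
  have hle' : ∀ᶠ N in Filter.atTop, ∀ t ∈ Set.Icc 0 T,
      ‖Pi t Z - projNadj d N (PiN N t (projN d N Z))‖ ≤ η N * ‖Z‖ := by
    filter_upwards [hle] with N hN t ht
    exact ContinuousLinearMap.le_of_opNorm_le _ (hN t ht) Z
  have hηZ : Filter.Tendsto (fun N => η N * ‖Z‖) Filter.atTop (nhds 0) := by
    simpa using hη.mul_const ‖Z‖
  refine ⟨fun t ht => squeeze_zero' (Filter.Eventually.of_forall fun _ => norm_nonneg _)
    (hle'.mono fun N hN => hN t ht) hηZ, ?_⟩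
  -- The supremum is taken in `[0,∞]`, so the uniform real bound is transferred there.
  have hE : Filter.Tendsto (fun N => ENNReal.ofReal (η N * ‖Z‖)) Filter.atTop (nhds 0) := by
    simpa using ENNReal.tendsto_ofReal hηZ
  refine tendsto_of_tendsto_of_tendsto_of_le_of_le' tendsto_const_nhds hE
    (Filter.Eventually.of_forall fun _ => zero_le) ?_
  filter_upwards [hle'] with N hN
  refine iSup₂_le fun t ht => ?_
  rw [← ofReal_norm]
  exact ENNReal.ofReal_le_ofReal (hN t ht)
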